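/- Let $\beta>\pi/2$ and let $\eta:\mathbb{R}\to\mathbb{R}$ be a smooth, nonnegative, even, convex function such that $\eta^{-1}(0)=[-\beta+\pi/2,\ \beta-\pi/2]$, such that for some $a>0$ one has $\eta(x)>1$ whenever $|x|>a$, and such that $\eta'(x)\neq 0$ whenever $\eta(x)=1$. The corresponding $\beta$-worm domain is $$\Omega_\beta=\Big\{(z,w)\in\mathbb{C}^2:\ w\neq 0,\ \big|z-e^{i\log|w|^2}\big|^2<1-\eta(\log|w|^2)\Big\}.$$ For a set $\Omega\subset\mathbb{C}^n$, a defining function of $\Omega$ is a real function $\rho$ that is $C^2$ on a neighborhood of $\overline\Omega$, with $\Omega=\{\rho<0\}$ and $\nabla\rho\neq 0$ on $\partial\Omega$. A number $\tau\in(0,1)$ is a Diederich–Fornæss exponent of $\Omega$ if there is a defining function $\rho$ of $\Omega$ such that $-(-\rho)^{\tau}$ is plurisubharmonic in $\Omega$. The Diederich–Fornæss index of $\Omega$ is the supremum of its Diederich–Fornæss exponents. Theorem. For every $\beta>\pi/2$ and every $\eta$ as above, $\Omega_\beta$ is a bounded pseudoconvex domain with smooth boundary, and its Diederich–Fornæss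 index is exactly $\pi/(2\beta)$. Moreover every value in $(0,1)$ occurs as an index: for every $\eta_0\in(0,1)$ there is a function $\eta$ as above for $\beta=\pi/(2\eta_0)$, and the resulting domain $\Omega_{\pi/(2\eta_0)}$ is a bounded pseudoconvex domain with smooth boundary in $\mathbb{C}^2$ of Diederich–Fornæss index $\eta_0$. -/

import Mathlib

open Set
open scoped ContDiff

noncomputable section

/-- A real-valued function `u` is plurisubharmonic on `Ω ⊆ ℂⁿ`: it is upper semicontinuous on `Ω`,
and whenever the closed disc `{z + ζ v : |ζ| ≤ 1}` of a complex line lies in `Ω`, the value of `u`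
at the centre is at most its mean over the boundary circle. (The mean of a finite-valued
plurisubharmonic function over such a circle is finite; this is the integrability clause.) -/
def IsPlurisubharmonicOn {n : ℕ} (u : EuclideanSpace ℂ (Fin n) → ℝ)
    (Ω : Set (EuclideanSpace ℂ (Fin n))) : Prop :=
  UpperSemicontinuousOn u Ω ∧
    ∀ z v : EuclideanSpace ℂ (Fin n), (∀ ζ : ℂ, ‖ζ‖ ≤ 1 → z + ζ • v ∈ Ω) →
      CircleIntegrable (fun ζ : ℂ => u (z + ζ • v)) 0 1 ∧
        u z ≤ Real.circleAverage (fun ζ : ℂ => u (z + ζ • v)) 0 1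

/-- `ρ` is a defining function of class `C^k` of `Ω ⊆ ℂⁿ`: it is `C^k` (in the real sense) on an
open neighbourhood `U` of the closure of `Ω`, `Ω = {ρ < 0}`, and the gradient of `ρ` does not
vanish on the boundary of `Ω`. -/
def IsDefiningFunction {n : ℕ} (k : WithTop ℕ∞) (Ω : Set (EuclideanSpace ℂ (Fin n)))
    (ρ : EuclideanSpace ℂ (Fin n) → ℝ) : Prop :=
  ∃ U : Set (EuclideanSpace ℂ (Fin n)), IsOpen U ∧ closure Ω ⊆ U ∧ ContDiffOn ℝ k ρ U ∧
    Ω = {z | z ∈ U ∧ ρ z < 0} ∧ ∀ z ∈ frontier Ω, fderiv ℝ ρ z ≠ 0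

/-- `Ω ⊆ ℂⁿ` is pseudoconvex: it is open and has a continuous plurisubharmonic exhaustion
function. -/
def IsPseudoconvex {n : ℕ} (Ω : Set (EuclideanSpace ℂ (Fin n))) : Prop :=
  IsOpen Ω ∧ ∃ φ : EuclideanSpace ℂ (Fin n) → ℝ, ContinuousOn φ Ω ∧ IsPlurisubharmonicOn φ Ω ∧
    ∀ c : ℝ, IsCompact {z | z ∈ Ω ∧ φ z ≤ c}

/-- `Ω ⊆ ℂⁿ` is a bounded pseudoconvex domain with smooth (`C^∞`) boundary. -/
structure IsSmoothBoundedPseudoconvexDomain {n : ℕ}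
    (Ω : Set (EuclideanSpace ℂ (Fin n))) : Prop where
  isOpen : IsOpen Ω
  isConnected : IsConnected Ω
  isBounded : Bornology.IsBounded Ω
  smooth_boundary : ∃ r : EuclideanSpace ℂ (Fin n) → ℝ, IsDefiningFunction ∞ Ω r
  pseudoconvex : IsPseudoconvex Ω

/-- `τ` is a Diederich–Fornæss exponent of `Ω`: `0 < τ < 1`, and there is a `C²` defining function
`ρ` of `Ω` such that `-(-ρ)^τ` is plurisubharmonic in `Ω`. -/
def IsDFExponent {n : ℕ} (Ω : Set (EuclideanSpace ℂ (Fin n))) (τ : ℝ) : Prop :=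
  0 < τ ∧ τ < 1 ∧ ∃ ρ : EuclideanSpace ℂ (Fin n) → ℝ, IsDefiningFunction 2 Ω ρ ∧
    IsPlurisubharmonicOn (fun z => -((-ρ z) ^ τ)) Ω

/-- The Diederich–Fornæss index of `Ω`: the supremum of its Diederich–Fornæss exponents, a subset
of `(0,1)` (and `0` if there are none). -/
def dfIndex {n : ℕ} (Ω : Set (EuclideanSpace ℂ (Fin n))) : ℝ :=
  sSup {τ : ℝ | IsDFExponent Ω τ}

/-- The functions `η : ℝ → ℝ` that are admissible in the definition of the `β`-worm domain. -/
structure IsWormProfile (β : ℝ) (η : ℝ → ℝ) : Prop where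
  smooth : ContDiff ℝ ∞ η
  nonneg : ∀ x, 0 ≤ η x
  even : ∀ x, η (-x) = η x
  convex : ConvexOn ℝ univ η
  zero_set : η ⁻¹' {0} = Icc (-β + Real.pi / 2) (β - Real.pi / 2)
  large : ∃ a : ℝ, 0 < a ∧ ∀ x, x < -a ∨ a < x → 1 < η x
  deriv_ne_zero : ∀ x, η x = 1 → deriv η x ≠ 0

/-- The worm domain in `ℂ²` given by `η`: the set of all `(z, w)` with `w ≠ 0` and
`|z - e^{i log |w|²}|² < 1 - η(log |w|²)`. The condition `w ≠ 0` is needed because `log |w|²` has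
no meaning at `w = 0`. -/
def wormDomain (η : ℝ → ℝ) : Set (EuclideanSpace ℂ (Fin 2)) :=
  {p | p 1 ≠ 0 ∧
    ‖p 0 - Complex.exp (Complex.I * (Real.log (‖p 1‖ ^ 2) : ℂ))‖ ^ 2
      < 1 - η (Real.log (‖p 1‖ ^ 2))}

end

noncomputable section

open Filter Topology MeasureTheory

/-! Write `L = log |w|²`, `R = wormFun η`, and `k = τ / (1 - τ)`. On a small disc with `w ≠ 0`,
choose a holomorphic branch `lw` of the logarithm of `w` divided by its central value. Then `R · exp
(2 Im lw)` is the real part of a holomorphic function, minus the squared modulus of another, minus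
`η(L) exp (2 Im lw)`; its Laplacian is at most `-4 |lw'|² η(L)`. Likewise `cos (k L) · exp (-2k Im
lw)` is harmonic. In the weighted geometric mean with weights `τ` and `1 - τ` the two exponential
factors cancel exactly, and geometric means preserve superharmonicity.

Exponents below `π/(2β)`: the condition `τ < π/(2β)` says `k (β - π/2) < π/2`, so `cos (k x)` is
positive on the zero set of `η` and extends to a positive `Ψ`. The function `-R Ψ(L)^(1/k)` then
works near the boundary: `Ψ'' + k² Ψ` vanishes near the zero set, and elsewhere the term `-τ η / R`
dominates close to the boundary. A concave truncation removes the interior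
(`exists_hasLap_wormFun_rpow`, `isDFExponent_of_deriv2_le`). The reciprocal of `(-ρ)^τ` is a
plurisubharmonic exhaustion, so pseudoconvexity comes for free.

No exponent above `π/(2β)`: the annulus `z = 0`, `|L| ≤ β - π/2` lies in the boundary. Rescaling `z`
by `δ → 0` turns `(-ρ)^τ` into `(h(w) Re (z e^{-iL}))^τ`, where `h` is the inner normal derivative,
and this limit inherits the super-mean value inequality (`circleAverage_fderiv_rpow_le`). If `τ >
π/(2β)`, some `k < τ / (1 - τ)` has `cos (k L)` vanishing inside the annulus. A multiple of `cos (k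
L)^(1-τ)` touches `h^τ` from below at an interior point, and the model function `Re (z e^{-iL})^τ
cos (k L)^(1-τ)` has positive Laplacian along a suitable complex line there (`hasLap_modelDisc`), a
contradiction. -/

lemma intervalIntegral_swap_of_continuousOn {F : ℝ → ℝ → ℝ} {a b c d : ℝ}
    (hF : ContinuousOn (Function.uncurry F) (uIcc a b ×ˢ uIcc c d)) :
    ∫ x in a..b, ∫ y in c..d, F x y = ∫ y in c..d, ∫ x in a..b, F x y := by
  apply MeasureTheory.intervalIntegral_intervalIntegral_swap
  have h1 := hF.integrableOn_compact (μ := (volume : Measure (ℝ × ℝ)))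
    (isCompact_uIcc.prod isCompact_uIcc)
  exact h1.mono_set (prod_mono uIoc_subset_uIcc uIoc_subset_uIcc)

/-! ### Sub-mean value inequality from a nonnegative Levi form -/

section SubMean

variable {E : Type*} [NormedAddCommGroup E] [NormedSpace ℂ E] [NormedSpace ℝ E]
  [IsScalarTower ℝ ℂ E]

lemma hasDerivAt_expI (v : E) (θ : ℝ) :
    HasDerivAt (fun θ : ℝ => Complex.exp (θ * Complex.I) • v)
      (Complex.I • Complex.exp (θ * Complex.I) • v) θ := by
  have h : HasDerivAt (fun θ : ℝ => Complex.exp (θ * Complex.I))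
      (Complex.exp (θ * Complex.I) * (1 * Complex.I)) θ :=
    (((hasDerivAt_id θ).ofReal_comp).mul_const Complex.I).cexp
  have := h.smul_const v
  convert this using 1
  rw [smul_smul]; ring_nf

/-- This is the divergence theorem in polar coordinates. The sum of `∂_r (r ∂_r u)` and `∂_θ (r⁻¹
∂_θ u)` is `r` times the Levi form, and the angular term integrates to zero by periodicity.
Integrating in `r` makes the mean of `∂_r u` nonnegative, and a second radial integration compares
the circle with its centre. -/
theorem le_circleAverage_of_levi_nonneg {S : Set E} (hS : IsOpen S) {u : E → ℝ}
    (hu : ContDiffOn ℝ 2 u S)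
    (hlevi : ∀ p ∈ S, ∀ v : E, 0 ≤ fderiv ℝ (fderiv ℝ u) p v v +
      fderiv ℝ (fderiv ℝ u) p (Complex.I • v) (Complex.I • v))
    (z v : E) (hz : ∀ ζ : ℂ, ‖ζ‖ ≤ 1 → z + ζ • v ∈ S) :
    CircleIntegrable (fun ζ : ℂ => u (z + ζ • v)) 0 1 ∧
      u z ≤ Real.circleAverage (fun ζ : ℂ => u (z + ζ • v)) 0 1 := by
  set e : ℝ → E := fun θ => Complex.exp (θ * Complex.I) • v with he
  set q : ℝ → ℝ → E := fun r θ => z + r • e θ with hq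
  have hmap : ∀ r θ : ℝ, q r θ = z + (r * Complex.exp (θ * Complex.I) : ℂ) • v := by
    intro r θ
    simp only [hq, he]
    rw [mul_smul, ← algebraMap_smul ℂ r (Complex.exp (θ * Complex.I) • v), Complex.coe_algebraMap]
  have hqS : ∀ r ∈ Icc (0:ℝ) 1, ∀ θ, q r θ ∈ S := by
    intro r hr θ
    rw [hmap]
    apply hz
    rw [norm_mul, Complex.norm_exp_ofReal_mul_I, mul_one, Complex.norm_real, Real.norm_eq_abs,
      abs_of_nonneg hr.1]
    exact hr.2
  have hec : Continuous e := by simp only [he]; fun_prop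
  have hqc : Continuous (fun x : ℝ × ℝ => q x.1 x.2) := by
    simp only [hq]; fun_prop
  set u1 := fderiv ℝ u with hu1
  set u2 := fderiv ℝ u1 with hu2
  have hu1d : ContDiffOn ℝ 1 u1 S := hu.fderiv_of_isOpen hS (by norm_num)
  have hu2d : ContinuousOn u2 S := (hu1d.continuousOn_fderiv_of_isOpen hS (by norm_num))
  have hD0 : ∀ p ∈ S, HasFDerivAt u (u1 p) p := fun p hp =>
    ((hu.differentiableOn (by norm_num)).differentiableAt (hS.mem_nhds hp)).hasFDerivAt
  have hD1 : ∀ p ∈ S, HasFDerivAt u1 (u2 p) p := fun p hp =>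
    ((hu1d.differentiableOn (by norm_num)).differentiableAt (hS.mem_nhds hp)).hasFDerivAt
  have hqr : ∀ r θ, HasDerivAt (fun r => q r θ) (e θ) r := by
    intro r θ
    have := ((hasDerivAt_id r).smul_const (e θ)).const_add z
    rwa [one_smul] at this
  have hqθ : ∀ r θ, HasDerivAt (fun θ => q r θ) (r • Complex.I • e θ) θ := by
    intro r θ
    exact ((hasDerivAt_expI v θ).const_smul r).const_add z
  have hIe : ∀ θ, HasDerivAt (fun θ => Complex.I • e θ) (- e θ) θ := by
    intro θ
    have := (hasDerivAt_expI v θ).const_smul Complex.I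
    rw [smul_smul Complex.I Complex.I, Complex.I_mul_I, neg_one_smul] at this
    exact this
  have c0 : ContinuousOn (fun x : ℝ × ℝ => u (q x.1 x.2)) (Icc 0 1 ×ˢ univ) :=
    hu.continuousOn.comp hqc.continuousOn (fun x hx => hqS _ hx.1 _)
  have c1 : ContinuousOn (fun x : ℝ × ℝ => u1 (q x.1 x.2)) (Icc 0 1 ×ˢ univ) :=
    hu1d.continuousOn.comp hqc.continuousOn (fun x hx => hqS _ hx.1 _)
  have c2 : ContinuousOn (fun x : ℝ × ℝ => u2 (q x.1 x.2)) (Icc 0 1 ×ˢ univ) :=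
    hu2d.comp hqc.continuousOn (fun x hx => hqS _ hx.1 _)
  have ce : ContinuousOn (fun x : ℝ × ℝ => e x.2) (Icc 0 1 ×ˢ univ) := by fun_prop
  have cIe : ContinuousOn (fun x : ℝ × ℝ => Complex.I • e x.2) (Icc 0 1 ×ˢ univ) := by fun_prop
  -- the radial derivative and the two components of the polar gradient field
  set G : ℝ → ℝ → ℝ := fun r θ => u1 (q r θ) (e θ) with hG
  set A' : ℝ → ℝ → ℝ := fun r θ => u1 (q r θ) (e θ) + r * u2 (q r θ) (e θ) (e θ) with hA'
  set B' : ℝ → ℝ → ℝ := fun r θ =>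
    r * u2 (q r θ) (Complex.I • e θ) (Complex.I • e θ) - u1 (q r θ) (e θ) with hB'
  have cG : ContinuousOn (Function.uncurry G) (Icc 0 1 ×ˢ univ) := c1.clm_apply ce
  have cA' : ContinuousOn (Function.uncurry A') (Icc 0 1 ×ˢ univ) :=
    (c1.clm_apply ce).add (continuousOn_fst.mul ((c2.clm_apply ce).clm_apply ce))
  have cB' : ContinuousOn (Function.uncurry B') (Icc 0 1 ×ˢ univ) :=
    (continuousOn_fst.mul ((c2.clm_apply cIe).clm_apply cIe)).sub (c1.clm_apply ce)
  have slice : ∀ {F : ℝ → ℝ → ℝ}, ContinuousOn (Function.uncurry F) (Icc 0 1 ×ˢ univ) →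
      ∀ r ∈ Icc (0:ℝ) 1, Continuous (fun θ => F r θ) := by
    intro F hF r hr
    exact hF.comp_continuous (Continuous.prodMk_right r) (fun θ => ⟨hr, mem_univ _⟩)
  have slice' : ∀ {F : ℝ → ℝ → ℝ}, ContinuousOn (Function.uncurry F) (Icc 0 1 ×ˢ univ) →
      ∀ θ, ContinuousOn (fun r => F r θ) (Icc 0 1) := by
    intro F hF θ
    exact hF.comp (Continuous.prodMk_left θ).continuousOn (fun r hr => ⟨hr, mem_univ _⟩)
  have hGd : ∀ r ∈ Icc (0:ℝ) 1, ∀ θ, HasDerivAt (fun r => u (q r θ)) (G r θ) r := by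
    intro r hr θ
    exact (hD0 _ (hqS r hr θ)).comp_hasDerivAt r (hqr r θ)
  have hAd : ∀ r ∈ Icc (0:ℝ) 1, ∀ θ, HasDerivAt (fun r => r * G r θ) (A' r θ) r := by
    intro r hr θ
    have h1 := (hD1 _ (hqS r hr θ)).comp_hasDerivAt r (hqr r θ)
    have h2 := h1.clm_apply (hasDerivAt_const r (e θ))
    have h3 := (hasDerivAt_id r).mul h2
    refine h3.congr_deriv ?_
    simp [hA']
  have hBd : ∀ r ∈ Icc (0:ℝ) 1, ∀ θ,
      HasDerivAt (fun θ => u1 (q r θ) (Complex.I • e θ)) (B' r θ) θ := by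
    intro r hr θ
    have h1 := (hD1 _ (hqS r hr θ)).comp_hasDerivAt θ (hqθ r θ)
    have h2 := h1.clm_apply (hIe θ)
    refine h2.congr_deriv ?_
    simp [hB', sub_eq_add_neg]
  have hper : e (2 * Real.pi) = e 0 := by
    simp only [he]
    congr 1
    push_cast
    rw [Complex.exp_two_pi_mul_I]; simp
  have intB : ∀ r ∈ Icc (0:ℝ) 1, ∫ θ in (0:ℝ)..2 * Real.pi, B' r θ = 0 := by
    intro r hr
    rw [intervalIntegral.integral_eq_sub_of_hasDerivAt (fun θ _ => hBd r hr θ)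
      ((slice cB' r hr).intervalIntegrable _ _)]
    simp only [hq, hper, sub_self]
  have intA : ∀ r ∈ Icc (0:ℝ) 1, 0 ≤ ∫ θ in (0:ℝ)..2 * Real.pi, A' r θ := by
    intro r hr
    -- Adding the integral of `B'`, which is zero, completes the integrand to `r` times the Levi
    -- form: the first-order terms cancel.
    have : ∫ θ in (0:ℝ)..2 * Real.pi, (A' r θ + B' r θ) =
        ∫ θ in (0:ℝ)..2 * Real.pi, A' r θ := by
      rw [intervalIntegral.integral_add ((slice cA' r hr).intervalIntegrable _ _)
        ((slice cB' r hr).intervalIntegrable _ _), intB r hr, add_zero]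
    rw [← this]
    apply intervalIntegral.integral_nonneg (by positivity)
    intro θ _
    have h := mul_nonneg hr.1 (hlevi _ (hqS r hr θ) (e θ))
    simp only [hA', hB']
    linarith
  have intG : ∀ r ∈ Icc (0:ℝ) 1, 0 ≤ r * ∫ θ in (0:ℝ)..2 * Real.pi, G r θ := by
    intro r hr
    have hsub : uIcc 0 r ⊆ Icc (0:ℝ) 1 := by
      rw [uIcc_of_le hr.1]; exact Icc_subset_Icc_right hr.2
    have h1 : ∀ θ, r * G r θ = ∫ s in (0:ℝ)..r, A' s θ := by
      intro θ
      rw [intervalIntegral.integral_eq_sub_of_hasDerivAt (fun s hs => hAd s (hsub hs) θ)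
        ((slice' cA' θ).mono hsub).intervalIntegrable]
      simp
    rw [← intervalIntegral.integral_const_mul]
    simp_rw [h1]
    rw [← intervalIntegral_swap_of_continuousOn (cA'.mono (prod_mono hsub (subset_univ _)))]
    apply intervalIntegral.integral_nonneg hr.1
    intro s hs
    exact intA s ⟨hs.1, hs.2.trans hr.2⟩
  have fin : 0 ≤ ∫ θ in (0:ℝ)..2 * Real.pi, (u (q 1 θ) - u z) := by
    have hsub : uIcc (0:ℝ) 1 ⊆ Icc (0:ℝ) 1 := by rw [uIcc_of_le zero_le_one]
    have h1 : ∀ θ, u (q 1 θ) - u z = ∫ s in (0:ℝ)..1, G s θ := by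
      intro θ
      rw [intervalIntegral.integral_eq_sub_of_hasDerivAt (fun s hs => hGd s (hsub hs) θ)
        ((slice' cG θ).mono hsub).intervalIntegrable]
      simp [hq]
    simp_rw [h1]
    rw [← intervalIntegral_swap_of_continuousOn (cG.mono (prod_mono hsub (subset_univ _)))]
    -- The half-open interval excludes `s = 0`, where `intG` carries no information because of its
    -- factor `r`.
    rw [intervalIntegral.integral_of_le zero_le_one]
    apply MeasureTheory.setIntegral_nonneg measurableSet_Ioc
    intro s hs
    exact nonneg_of_mul_nonneg_right (intG s ⟨hs.1.le, hs.2⟩) hs.1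
  have hcm : ∀ θ, z + circleMap 0 1 θ • v = q 1 θ := by
    intro θ; rw [hmap]; simp [circleMap]
  have c01 : Continuous (fun θ => u (q 1 θ)) :=
    slice (F := fun r θ => u (q r θ)) c0 1 ⟨zero_le_one, le_rfl⟩
  constructor
  · unfold CircleIntegrable
    simp_rw [hcm]
    exact c01.intervalIntegrable _ _
  · unfold Real.circleAverage
    simp_rw [hcm]
    rw [intervalIntegral.integral_sub (c01.intervalIntegrable _ _) (by simp)] at fin
    rw [intervalIntegral.integral_const, sub_zero, smul_eq_mul] at fin
    rw [smul_eq_mul, inv_mul_eq_div, le_div_iff₀ (by positivity)]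
    linarith

end SubMean

/-! ### Second-order calculus along complex lines -/

/-- `f : ℝ → F` has value `c`, first derivative `a` and second derivative `s` at `0`. -/
def HasJet2 {F : Type*} [NormedAddCommGroup F] [NormedSpace ℝ F] (f : ℝ → F) (c a s : F) : Prop :=
  ∃ f' : ℝ → F, (∀ᶠ t in 𝓝 0, HasDerivAt f (f' t) t) ∧ HasDerivAt f' s 0 ∧ f 0 = c ∧ f' 0 = a

namespace HasJet2

variable {F : Type*} [NormedAddCommGroup F] [NormedSpace ℝ F]

lemma const (c : F) : HasJet2 (fun _ => c) c 0 0 :=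
  ⟨fun _ => 0, Eventually.of_forall fun t => hasDerivAt_const t c, hasDerivAt_const _ _, rfl, rfl⟩

lemma add {f g : ℝ → F} {c a s c' a' s' : F} (hf : HasJet2 f c a s) (hg : HasJet2 g c' a' s') :
    HasJet2 (fun t => f t + g t) (c + c') (a + a') (s + s') := by
  obtain ⟨f', h1, h2, h3, h4⟩ := hf
  obtain ⟨g', k1, k2, k3, k4⟩ := hg
  refine ⟨fun t => f' t + g' t, ?_, h2.add k2, by simp [h3, k3], by simp [h4, k4]⟩
  filter_upwards [h1, k1] with t ht kt using ht.add kt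

lemma mul {f g : ℝ → ℝ} {c a s c' a' s' : ℝ} (hf : HasJet2 f c a s) (hg : HasJet2 g c' a' s') :
    HasJet2 (fun t => f t * g t) (c * c') (a * c' + c * a') (s * c' + 2 * (a * a') + c * s') := by
  obtain ⟨f', h1, h2, h3, h4⟩ := hf
  obtain ⟨g', k1, k2, k3, k4⟩ := hg
  refine ⟨fun t => f' t * g t + f t * g' t, ?_, ?_, by simp [h3, k3], by simp [h3, k3, h4, k4]⟩
  · filter_upwards [h1, k1] with t ht kt using ht.mul kt
  · refine ((h2.mul k1.self_of_nhds).add (h1.self_of_nhds.mul k2)).congr_deriv ?_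
    rw [h3, h4, k3, k4]; ring

lemma comp {φ φ' : ℝ → ℝ} {φ2 : ℝ} {f : ℝ → ℝ} {c a s : ℝ} (hf : HasJet2 f c a s)
    (hφ : ∀ᶠ x in 𝓝 c, HasDerivAt φ (φ' x) x) (hφ' : HasDerivAt φ' φ2 c) :
    HasJet2 (fun t => φ (f t)) (φ c) (φ' c * a) (φ' c * s + φ2 * a ^ 2) := by
  obtain ⟨f', h1, h2, h3, h4⟩ := hf
  refine ⟨fun t => φ' (f t) * f' t, ?_, ?_, by simp [h3], by simp [h3, h4]⟩
  · have hc : Tendsto f (𝓝 0) (𝓝 c) := by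
      have := h1.self_of_nhds.continuousAt.tendsto
      rwa [h3] at this
    filter_upwards [h1, hc.eventually hφ] with t ht kt using kt.comp t ht
  · have hφ'' : HasDerivAt φ' φ2 (f 0) := by rwa [h3]
    refine ((hφ''.comp (0:ℝ) h1.self_of_nhds).mul h2).congr_deriv ?_
    simp only [Function.comp, h3, h4]; ring

lemma congr {f g : ℝ → F} {c a s : F} (hf : HasJet2 f c a s) (h : g =ᶠ[𝓝 0] f) :
    HasJet2 g c a s := by
  obtain ⟨f', h1, h2, h3, h4⟩ := hf
  refine ⟨f', ?_, h2, by rw [h.self_of_nhds, h3], h4⟩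
  filter_upwards [h1, eventually_eventually_nhds.2 h] with t ht kt using ht.congr_of_eventuallyEq kt

lemma re {f : ℝ → ℂ} {c a s : ℂ} (hf : HasJet2 f c a s) :
    HasJet2 (fun t => (f t).re) c.re a.re s.re := by
  obtain ⟨f', h1, h2, h3, h4⟩ := hf
  refine ⟨fun t => (f' t).re, ?_, ?_, by simp [h3], by simp [h4]⟩
  · filter_upwards [h1] with t ht
    exact Complex.reCLM.hasFDerivAt.comp_hasDerivAt t ht
  · exact Complex.reCLM.hasFDerivAt.comp_hasDerivAt (0:ℝ) h2

lemma im {f : ℝ → ℂ} {c a s : ℂ} (hf : HasJet2 f c a s) :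
    HasJet2 (fun t => (f t).im) c.im a.im s.im := by
  obtain ⟨f', h1, h2, h3, h4⟩ := hf
  refine ⟨fun t => (f' t).im, ?_, ?_, by simp [h3], by simp [h4]⟩
  · filter_upwards [h1] with t ht
    exact Complex.imCLM.hasFDerivAt.comp_hasDerivAt t ht
  · exact Complex.imCLM.hasFDerivAt.comp_hasDerivAt (0:ℝ) h2

lemma of_analyticAt {H : ℂ → ℂ} (hH : AnalyticAt ℂ H 0) (e : ℂ) :
    HasJet2 (fun t : ℝ => H (t * e)) (H 0) (deriv H 0 * e) (deriv (deriv H) 0 * e ^ 2) := by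
  have hl : ∀ t : ℝ, HasDerivAt (fun t : ℝ => (t : ℂ) * e) e t := fun t => by
    simpa using (hasDerivAt_id t).ofReal_comp.mul_const e
  have ht : Tendsto (fun t : ℝ => (t : ℂ) * e) (𝓝 0) (𝓝 0) := by
    have := (hl 0).continuousAt.tendsto; simpa using this
  refine ⟨fun t => deriv H (t * e) * e, ?_, ?_, by simp, by simp⟩
  · filter_upwards [ht.eventually hH.eventually_analyticAt] with t h
    exact h.differentiableAt.hasDerivAt.comp t (hl t)
  · have h2 : HasDerivAt (deriv H) (deriv (deriv H) 0) (((0:ℝ):ℂ) * e) := by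
      simpa using hH.deriv.differentiableAt.hasDerivAt
    refine ((h2.comp (0:ℝ) (hl 0)).mul_const e).congr_deriv ?_
    ring

lemma of_contDiffAt {E : Type*} [NormedAddCommGroup E] [NormedSpace ℝ E] {u : E → ℝ}
    {p : E} (hu : ContDiffAt ℝ 2 u p) (v : E) :
    HasJet2 (fun t : ℝ => u (p + t • v)) (u p) (fderiv ℝ u p v)
      (fderiv ℝ (fderiv ℝ u) p v v) := by
  have hl : ∀ t : ℝ, HasDerivAt (fun t : ℝ => p + t • v) v t := fun t => by
    simpa using ((hasDerivAt_id t).smul_const v).const_add p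
  have ht : Tendsto (fun t : ℝ => p + t • v) (𝓝 0) (𝓝 p) := by
    have := (hl 0).continuousAt.tendsto; simpa using this
  have hd : ∀ᶠ x in 𝓝 p, HasFDerivAt u (fderiv ℝ u x) x := by
    filter_upwards [hu.eventually (by simp)] with x hx
    exact (hx.differentiableAt (by norm_num)).hasFDerivAt
  have hd2 : HasFDerivAt (fderiv ℝ u) (fderiv ℝ (fderiv ℝ u) p) (p + (0:ℝ) • v) := by
    have : ContDiffAt ℝ 1 (fderiv ℝ u) p := hu.fderiv_right (by norm_num)
    simpa using (this.differentiableAt (by norm_num)).hasFDerivAt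
  refine ⟨fun t => fderiv ℝ u (p + t • v) v, ?_, ?_, by simp, by simp⟩
  · filter_upwards [ht.eventually hd] with t k2
    exact k2.comp_hasDerivAt t (hl t)
  · have k1 : HasDerivAt (fun t : ℝ => fderiv ℝ u (p + t • v)) (fderiv ℝ (fderiv ℝ u) p v) 0 :=
      hd2.comp_hasDerivAt (0:ℝ) (hl 0)
    have k2 : HasFDerivAt (fun g : E →L[ℝ] ℝ => g v) (ContinuousLinearMap.apply ℝ ℝ v)
      (fderiv ℝ u (p + (0:ℝ) • v)) := (ContinuousLinearMap.apply ℝ ℝ v).hasFDerivAt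
    exact k2.comp_hasDerivAt (0:ℝ) k1

lemma fderiv_fderiv_eq {E : Type*} [NormedAddCommGroup E] [NormedSpace ℝ E] {u : E → ℝ} {p v : E}
    (hu : ContDiffAt ℝ 2 u p) {c a s : ℝ} (h : HasJet2 (fun t : ℝ => u (p + t • v)) c a s) :
    fderiv ℝ (fderiv ℝ u) p v v = s := by
  obtain ⟨f', h1, h2, -, -⟩ := h
  obtain ⟨g', k1, k2, -, -⟩ := of_contDiffAt hu v
  have e : f' =ᶠ[𝓝 0] g' := by
    filter_upwards [h1, k1] with t ht kt using ht.unique kt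
  exact k2.unique (h2.congr_of_eventuallyEq e.symm)

end HasJet2

/-- `F : ℂ → ℝ` has value `c`, partial derivatives `gx`, `gy` and Laplacian `Λ` at `0`
(computed along the two coordinate axes). -/
def HasLap (F : ℂ → ℝ) (c gx gy Λ : ℝ) : Prop :=
  ∃ sx sy, sx + sy = Λ ∧ HasJet2 (fun t : ℝ => F (t * 1)) c gx sx ∧
    HasJet2 (fun t : ℝ => F (t * Complex.I)) c gy sy

namespace HasLap

lemma const (c : ℝ) : HasLap (fun _ => c) c 0 0 0 :=
  ⟨0, 0, by simp, HasJet2.const c, HasJet2.const c⟩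

lemma add {F G : ℂ → ℝ} {c gx gy Λ c' gx' gy' Λ' : ℝ} (hF : HasLap F c gx gy Λ)
    (hG : HasLap G c' gx' gy' Λ') :
    HasLap (fun ζ => F ζ + G ζ) (c + c') (gx + gx') (gy + gy') (Λ + Λ') := by
  obtain ⟨sx, sy, h, hx, hy⟩ := hF
  obtain ⟨sx', sy', h', hx', hy'⟩ := hG
  exact ⟨_, _, by rw [← h, ← h']; ring, hx.add hx', hy.add hy'⟩

lemma mul {F G : ℂ → ℝ} {c gx gy Λ c' gx' gy' Λ' : ℝ} (hF : HasLap F c gx gy Λ)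
    (hG : HasLap G c' gx' gy' Λ') :
    HasLap (fun ζ => F ζ * G ζ) (c * c') (gx * c' + c * gx') (gy * c' + c * gy')
      (Λ * c' + 2 * (gx * gx' + gy * gy') + c * Λ') := by
  obtain ⟨sx, sy, h, hx, hy⟩ := hF
  obtain ⟨sx', sy', h', hx', hy'⟩ := hG
  exact ⟨_, _, by rw [← h, ← h']; ring, hx.mul hx', hy.mul hy'⟩

lemma const_mul {F : ℂ → ℝ} {c gx gy Λ : ℝ} (k : ℝ) (hF : HasLap F c gx gy Λ) :
    HasLap (fun ζ => k * F ζ) (k * c) (k * gx) (k * gy) (k * Λ) := by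
  simpa using (const k).mul hF

lemma comp {F : ℂ → ℝ} {c gx gy Λ : ℝ} (hF : HasLap F c gx gy Λ) {φ φ' : ℝ → ℝ} {φ2 : ℝ}
    (hφ : ∀ᶠ x in 𝓝 c, HasDerivAt φ (φ' x) x) (hφ' : HasDerivAt φ' φ2 c) :
    HasLap (fun ζ => φ (F ζ)) (φ c) (φ' c * gx) (φ' c * gy)
      (φ' c * Λ + φ2 * (gx ^ 2 + gy ^ 2)) := by
  obtain ⟨sx, sy, h, hx, hy⟩ := hF
  exact ⟨_, _, by rw [← h]; ring, hx.comp hφ hφ', hy.comp hφ hφ'⟩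

lemma comp_contDiff {F : ℂ → ℝ} {c gx gy Λ : ℝ} (hF : HasLap F c gx gy Λ) {φ : ℝ → ℝ}
    (hφ : ContDiff ℝ 2 φ) :
    HasLap (fun ζ => φ (F ζ)) (φ c) (deriv φ c * gx) (deriv φ c * gy)
      (deriv φ c * Λ + deriv (deriv φ) c * (gx ^ 2 + gy ^ 2)) := by
  have h1 : ContDiff ℝ 1 (deriv φ) := by
    have : ContDiff ℝ (1 + 1) φ := by simpa [one_add_one_eq_two] using hφ
    exact this.deriv'
  exact hF.comp (Eventually.of_forall fun x => (hφ.differentiable (by norm_num) x).hasDerivAt)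
    (h1.differentiable (by norm_num) c).hasDerivAt

lemma congr {F G : ℂ → ℝ} {c gx gy Λ : ℝ} (hF : HasLap F c gx gy Λ) (h : G =ᶠ[𝓝 0] F) :
    HasLap G c gx gy Λ := by
  obtain ⟨sx, sy, hs, hx, hy⟩ := hF
  have ht : ∀ e : ℂ, Tendsto (fun t : ℝ => (t : ℂ) * e) (𝓝 0) (𝓝 0) := fun e => by
    have : Continuous (fun t : ℝ => (t : ℂ) * e) := by fun_prop
    simpa using this.tendsto 0
  exact ⟨sx, sy, hs, hx.congr ((ht 1).eventually h), hy.congr ((ht Complex.I).eventually h)⟩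

lemma of_eq {F : ℂ → ℝ} {c gx gy Λ c' gx' gy' Λ' : ℝ} (hF : HasLap F c gx gy Λ)
    (h1 : c = c') (h2 : gx = gx') (h3 : gy = gy') (h4 : Λ = Λ') : HasLap F c' gx' gy' Λ' := by
  subst h1 h2 h3 h4; exact hF

lemma re {H : ℂ → ℂ} (hH : AnalyticAt ℂ H 0) :
    HasLap (fun ζ => (H ζ).re) (H 0).re (deriv H 0).re (-(deriv H 0).im) 0 := by
  refine ⟨(deriv (deriv H) 0 * 1 ^ 2).re, (deriv (deriv H) 0 * Complex.I ^ 2).re, by simp, ?_, ?_⟩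
  · simpa using (HasJet2.of_analyticAt hH 1).re
  · simpa using (HasJet2.of_analyticAt hH Complex.I).re

lemma im {H : ℂ → ℂ} (hH : AnalyticAt ℂ H 0) :
    HasLap (fun ζ => (H ζ).im) (H 0).im (deriv H 0).im (deriv H 0).re 0 := by
  refine ⟨(deriv (deriv H) 0 * 1 ^ 2).im, (deriv (deriv H) 0 * Complex.I ^ 2).im, by simp, ?_, ?_⟩
  · simpa using (HasJet2.of_analyticAt hH 1).im
  · simpa using (HasJet2.of_analyticAt hH Complex.I).im

/-- Bridge between the Levi form and the jet calculus: the two diagonal second derivatives are those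
along `t ↦ p + t v` and `t ↦ p + t (I v)`, so any convenient expression for `u` along the complex
line may be differentiated instead. -/
lemma levi_eq {E : Type*} [NormedAddCommGroup E] [NormedSpace ℂ E] [NormedSpace ℝ E]
    [IsScalarTower ℝ ℂ E] {u : E → ℝ} {p v : E} (hu : ContDiffAt ℝ 2 u p) {c gx gy Λ : ℝ}
    (h : HasLap (fun ζ => u (p + ζ • v)) c gx gy Λ) :
    fderiv ℝ (fderiv ℝ u) p v v +
      fderiv ℝ (fderiv ℝ u) p (Complex.I • v) (Complex.I • v) = Λ := by
  obtain ⟨sx, sy, hs, hx, hy⟩ := h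
  have key : ∀ (t : ℝ) (e : ℂ), ((t : ℂ) * e) • v = t • e • v := fun t e => by
    rw [mul_smul, ← algebraMap_smul ℂ t, Complex.coe_algebraMap]
  simp only [key] at hx hy
  rw [one_smul] at hx
  rw [hx.fderiv_fderiv_eq hu, hy.fderiv_fderiv_eq hu, hs]

end HasLap

/-- The Laplacian of a weighted geometric mean of two positive functions. -/
lemma HasLap.rpow_mul_rpow {A B : ℂ → ℝ} {a ax ay ΛA b bx bay ΛB τ : ℝ}
    (hA : HasLap A a ax ay ΛA) (hB : HasLap B b bx bay ΛB) (ha : 0 < a) (hb : 0 < b) :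
    HasLap (fun ζ => A ζ ^ τ * B ζ ^ (1 - τ)) (a ^ τ * b ^ (1 - τ))
      (a ^ τ * b ^ (1 - τ) * (τ * ax / a + (1 - τ) * bx / b))
      (a ^ τ * b ^ (1 - τ) * (τ * ay / a + (1 - τ) * bay / b))
      (a ^ τ * b ^ (1 - τ) * (τ * ΛA / a + (1 - τ) * ΛB / b -
        τ * (1 - τ) * ((ax / a - bx / b) ^ 2 + (ay / a - bay / b) ^ 2))) := by
  have pw : ∀ (σ x : ℝ), 0 < x → (∀ᶠ y in 𝓝 x, HasDerivAt (fun y : ℝ => y ^ σ)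
      (σ * y ^ (σ - 1)) y) ∧ HasDerivAt (fun y : ℝ => σ * y ^ (σ - 1))
        (σ * ((σ - 1) * x ^ (σ - 1 - 1))) x := by
    intro σ x hx
    refine ⟨?_, (Real.hasDerivAt_rpow_const (Or.inl hx.ne')).const_mul σ⟩
    filter_upwards [lt_mem_nhds hx] with y hy
    exact Real.hasDerivAt_rpow_const (Or.inl (ne_of_gt hy))
  have h := (hA.comp (pw τ a ha).1 (pw τ a ha).2).mul
    (hB.comp (pw (1 - τ) b hb).1 (pw (1 - τ) b hb).2)
  have r1 : ∀ (σ x : ℝ), 0 < x → x ^ (σ - 1) = x ^ σ / x := fun σ x hx => by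
    rw [Real.rpow_sub_one hx.ne']
  refine h.of_eq rfl ?_ ?_ ?_
  · rw [r1 τ a ha, r1 (1 - τ) b hb]; field_simp
  · rw [r1 τ a ha, r1 (1 - τ) b hb]; field_simp
  · rw [r1 (τ - 1) a ha, r1 (1 - τ - 1) b hb, r1 τ a ha, r1 (1 - τ) b hb]
    field_simp
    ring

/-! ### The worm function in logarithmic coordinates and the Laplacian estimate -/

/-- `log |w|²`. -/
def logSq (p : EuclideanSpace ℂ (Fin 2)) : ℝ := Real.log (‖p 1‖ ^ 2)

/-- `1 - η(log |w|²) - |z - e^{i log |w|²}|²`, expanded. -/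
def wormFun (η : ℝ → ℝ) (p : EuclideanSpace ℂ (Fin 2)) : ℝ :=
  2 * (p 0 * Complex.exp (-(Complex.I * (logSq p : ℂ)))).re - ‖p 0‖ ^ 2 - η (logSq p)

lemma norm_sub_exp_sq (z : ℂ) (L : ℝ) :
    ‖z - Complex.exp (Complex.I * (L : ℂ))‖ ^ 2 =
      ‖z‖ ^ 2 - 2 * (z * Complex.exp (-(Complex.I * (L : ℂ)))).re + 1 := by
  have h1 : ‖Complex.exp (Complex.I * (L : ℂ))‖ = 1 := by
    rw [mul_comm]; exact Complex.norm_exp_ofReal_mul_I L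
  have h2 : Complex.exp (-(Complex.I * (L : ℂ))) =
      (starRingEnd ℂ) (Complex.exp (Complex.I * (L : ℂ))) := by
    rw [← Complex.exp_conj]; simp
  rw [h2, ← Complex.normSq_eq_norm_sq, Complex.normSq_sub, Complex.normSq_eq_norm_sq,
    Complex.normSq_eq_norm_sq, h1]
  ring

lemma wormFun_eq (η : ℝ → ℝ) (p : EuclideanSpace ℂ (Fin 2)) :
    wormFun η p = 1 - η (logSq p) - ‖p 0 - Complex.exp (Complex.I * (logSq p : ℂ))‖ ^ 2 := by
  rw [norm_sub_exp_sq, wormFun]; ring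

lemma mem_wormDomain {η : ℝ → ℝ} {p : EuclideanSpace ℂ (Fin 2)} :
    p ∈ wormDomain η ↔ p 1 ≠ 0 ∧ 0 < wormFun η p := by
  rw [wormFun_eq, sub_pos]; rfl

/-- The function is the pullback under `2 lw` of `φ(L + x) e^{-k y}`, whose Laplacian is `(φ'' + k²
φ) e^{-k y}`; a holomorphic change of variable multiplies it by `|2 lw'|²`. It is used with `φ = Ψ`,
and with `φ = η` and `k = -1`. -/
lemma HasLap.prod_exp {lw : ℂ → ℂ} (hlw : AnalyticAt ℂ lw 0) (hlw0 : lw 0 = 0) {φ : ℝ → ℝ}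
    (hφ : ContDiff ℝ 2 φ) (L k : ℝ) :
    ∃ gx gy, HasLap (fun ζ => φ (L + 2 * (lw ζ).re) * Real.exp (-k * (2 * (lw ζ).im))) (φ L) gx gy
      (4 * ‖deriv lw 0‖ ^ 2 * (deriv (deriv φ) L + k ^ 2 * φ L)) := by
  have hX := (HasLap.const L).add ((HasLap.re hlw).const_mul 2)
  have hY := ((HasLap.im hlw).const_mul 2).const_mul (-k)
  have hE := hY.comp_contDiff (φ := Real.exp) (Real.contDiff_exp.of_le le_top)
  have h := (hX.comp_contDiff hφ).mul hE
  refine ⟨_, _, h.of_eq ?_ rfl rfl ?_⟩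
  · simp [hlw0]
  · simp only [hlw0, Complex.zero_re, Complex.zero_im, mul_zero, add_zero, Real.deriv_exp,
      Real.exp_zero, zero_add]
    rw [← Complex.normSq_eq_norm_sq, Complex.normSq_apply]
    ring

/-- The choice `k (1 - τ) = τ` makes the weights `exp (2 Im lw)` on `R` and `exp (-2k Im lw)` on `Ψ`
cancel in the geometric mean, so both factors may be replaced by their weighted versions. Those have
Laplacians that are easy to bound, and `HasLap.rpow_mul_rpow` combines them. -/
theorem exists_hasLap_wormFun_rpow {η Ψ : ℝ → ℝ} (hη : ContDiff ℝ 2 η)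
    (hη2 : ∀ x, 0 ≤ deriv (deriv η) x) (hΨ : ContDiff ℝ 2 Ψ) (hΨ0 : ∀ x, 0 < Ψ x) {τ k : ℝ}
    (hτ0 : 0 < τ) (hτ1 : τ < 1) (hk : k * (1 - τ) = τ) (p v : EuclideanSpace ℂ (Fin 2))
    (hp : p 1 ≠ 0) (hR : 0 < wormFun η p) :
    ∃ gx gy Λ K, 0 ≤ K ∧
      HasLap (fun ζ => wormFun η (p + ζ • v) ^ τ * Ψ (logSq (p + ζ • v)) ^ (1 - τ))
        (wormFun η p ^ τ * Ψ (logSq p) ^ (1 - τ)) gx gy Λ ∧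
      Λ ≤ K * ((1 - τ) * (deriv (deriv Ψ) (logSq p) + k ^ 2 * Ψ (logSq p)) / Ψ (logSq p) -
        τ * η (logSq p) / wormFun η p) := by
  set b : ℂ := v 1 / p 1 with hb
  set L : ℝ := logSq p with hL
  -- A branch of `log (w / p 1)` along the disc, vanishing at the centre; its real part gives the
  -- change of `L` and its imaginary part the change of argument.
  set lw : ℂ → ℂ := fun ζ => Complex.log (1 + ζ * b) with hlwd
  have hlw0 : lw 0 = 0 := by simp [hlwd]
  have hlw : AnalyticAt ℂ lw 0 := by
    apply AnalyticAt.clog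
    · fun_prop
    · simp
  -- Since `-2i lw = -2i Re lw + 2 Im lw`, the factor `exp (2 Im lw)` turns `z e^{-i log |w|²}` into
  -- the holomorphic `q1` and `|z|²` into `|q2|²`.
  set q1 : ℂ → ℂ := fun ζ => (p 0 + ζ * v 0) * Complex.exp (-(Complex.I * (L : ℂ))) *
    Complex.exp (-(2 * Complex.I * lw ζ)) with hq1
  set q2 : ℂ → ℂ := fun ζ => (p 0 + ζ * v 0) * Complex.exp (-(Complex.I * lw ζ)) with hq2
  have hq1a : AnalyticAt ℂ q1 0 := by
    have : AnalyticAt ℂ (fun ζ => Complex.exp (-(2 * Complex.I * lw ζ))) 0 :=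
      (analyticAt_const.mul hlw).neg.cexp
    exact AnalyticAt.mul (by fun_prop) this
  have hq2a : AnalyticAt ℂ q2 0 := by
    have : AnalyticAt ℂ (fun ζ => Complex.exp (-(Complex.I * lw ζ))) 0 :=
      (analyticAt_const.mul hlw).neg.cexp
    exact AnalyticAt.mul (by fun_prop) this
  obtain ⟨bx, bay, hB⟩ := HasLap.prod_exp hlw hlw0 hΨ L k
  obtain ⟨ex, ey, hC⟩ := HasLap.prod_exp hlw hlw0 hη L (-1)
  have hN := ((HasLap.re hq2a).mul (HasLap.re hq2a)).add ((HasLap.im hq2a).mul (HasLap.im hq2a))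
  have hA := (((HasLap.re hq1a).const_mul 2).add (hN.const_mul (-1))).add (hC.const_mul (-1))
  -- the functions in logarithmic coordinates
  have hL' : ∀ᶠ ζ in 𝓝 (0:ℂ), logSq (p + ζ • v) = L + 2 * (lw ζ).re ∧
      1 + ζ * b ≠ 0 := by
    have hc : Tendsto (fun ζ : ℂ => 1 + ζ * b) (𝓝 0) (𝓝 1) := by
      have : Continuous (fun ζ : ℂ => 1 + ζ * b) := by fun_prop
      simpa using this.tendsto 0
    filter_upwards [hc.eventually (isOpen_ne.mem_nhds one_ne_zero)] with ζ hζ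
    refine ⟨?_, hζ⟩
    have e1 : (p + ζ • v) 1 = p 1 * (1 + ζ * b) := by
      simp only [PiLp.add_apply, PiLp.smul_apply, smul_eq_mul, hb]
      field_simp
    simp only [hL, logSq, e1, hlwd, Complex.log_re, norm_mul]
    rw [mul_pow, Real.log_mul (by simpa using hp) (by simpa using hζ), Real.log_pow ‖1 + ζ * b‖]
    rfl
  have hAeq : ∀ᶠ ζ in 𝓝 (0:ℂ), 2 * (q1 ζ).re +
      (-1) * ((q2 ζ).re * (q2 ζ).re + (q2 ζ).im * (q2 ζ).im) +
      (-1) * (η (L + 2 * (lw ζ).re) * Real.exp (-(-1) * (2 * (lw ζ).im))) =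
        wormFun η (p + ζ • v) * Real.exp (2 * (lw ζ).im) := by
    filter_upwards [hL'] with ζ hζ
    have e0 : (p + ζ • v) 0 = p 0 + ζ * v 0 := by simp
    have n2 : (q2 ζ).re * (q2 ζ).re + (q2 ζ).im * (q2 ζ).im =
        ‖p 0 + ζ * v 0‖ ^ 2 * Real.exp (2 * (lw ζ).im) := by
      rw [← Complex.normSq_apply, Complex.normSq_eq_norm_sq, hq2]
      simp only [norm_mul, Complex.norm_exp, mul_pow]
      rw [← Real.exp_nat_mul]
      simp
    have n1 : q1 ζ = (p 0 + ζ * v 0) *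
        Complex.exp (-(Complex.I * ((L + 2 * (lw ζ).re : ℝ) : ℂ))) *
          ((Real.exp (2 * (lw ζ).im) : ℝ) : ℂ) := by
      rw [Complex.ofReal_exp, hq1]
      simp only [mul_assoc, ← Complex.exp_add]
      congr 2
      conv_lhs => rw [← Complex.re_add_im (lw ζ)]
      push_cast
      ring_nf
      rw [Complex.I_sq]
      ring
    rw [n2, n1, wormFun, hζ.1, e0, Complex.re_mul_ofReal]
    simp only [neg_neg, one_mul]
    ring
  have hA0 : 2 * (q1 0).re + (-1) * ((q2 0).re * (q2 0).re + (q2 0).im * (q2 0).im) +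
      (-1) * η L = wormFun η p := by
    have := hAeq.self_of_nhds
    simpa [hlw0] using this
  rw [hA0] at hA
  refine ⟨_, _, _, 4 * ‖deriv lw 0‖ ^ 2 * (wormFun η p ^ τ * Ψ L ^ (1 - τ)), ?_,
    (hA.rpow_mul_rpow hB hR (hΨ0 L)).congr ?_, ?_⟩
  · have := hΨ0 L
    positivity
  · have hpos : ∀ᶠ ζ in 𝓝 (0:ℂ), 0 < wormFun η (p + ζ • v) := by
      have hcont : ContinuousAt (fun ζ => 2 * (q1 ζ).re +
          (-1) * ((q2 ζ).re * (q2 ζ).re + (q2 ζ).im * (q2 ζ).im) +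
          (-1) * (η (L + 2 * (lw ζ).re) * Real.exp (-(-1) * (2 * (lw ζ).im)))) 0 := by
        have c1 := hq1a.continuousAt
        have c2 := hq2a.continuousAt
        have c3 := hlw.continuousAt
        have c4 : Continuous η := hη.continuous
        have r1 := Complex.continuous_re.continuousAt.comp c1
        have r2 := Complex.continuous_re.continuousAt.comp c2
        have i2 := Complex.continuous_im.continuousAt.comp c2
        have r3 := Complex.continuous_re.continuousAt.comp c3
        have i3 := Complex.continuous_im.continuousAt.comp c3
        have c5 : ContinuousAt (fun ζ => η (L + 2 * (lw ζ).re)) 0 :=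
          c4.continuousAt.comp (continuousAt_const.add (continuousAt_const.mul r3))
        have c6 : ContinuousAt (fun ζ => Real.exp (-(-1) * (2 * (lw ζ).im))) 0 :=
          Real.continuous_exp.continuousAt.comp
            (continuousAt_const.mul (continuousAt_const.mul i3))
        exact ((continuousAt_const.mul r1).add
          (continuousAt_const.mul ((r2.mul r2).add (i2.mul i2)))).add
            (continuousAt_const.mul (c5.mul c6))
      have hev := hcont.eventually (lt_mem_nhds (a := 0) (by
        beta_reduce; rw [hAeq.self_of_nhds, zero_smul, add_zero]; positivity))
      filter_upwards [hev, hAeq] with ζ h1 h2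
      rw [h2] at h1
      exact pos_of_mul_pos_left h1 (Real.exp_pos _).le
    filter_upwards [hL', hAeq, hpos] with ζ h1 h2 h3
    rw [h2, h1.1, Real.mul_rpow h3.le (Real.exp_pos _).le,
      Real.mul_rpow (hΨ0 _).le (Real.exp_pos _).le, ← Real.exp_mul, ← Real.exp_mul]
    have : Real.exp (2 * (lw ζ).im * τ) * Real.exp (-k * (2 * (lw ζ).im) * (1 - τ)) = 1 := by
      rw [← Real.exp_add, Real.exp_eq_one_iff]
      linear_combination (-2 * (lw ζ).im) * hk
    linear_combination (-(wormFun η (p + ζ • v) ^ τ * Ψ (L + 2 * (lw ζ).re) ^ (1 - τ))) * this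
  · have hP : 0 < wormFun η p ^ τ * Ψ L ^ (1 - τ) := by
      have := hΨ0 L
      positivity
    generalize wormFun η p ^ τ * Ψ L ^ (1 - τ) = P at hP
    rw [mul_comm _ P, mul_assoc P]
    apply mul_le_mul_of_nonneg_left _ hP.le
    have hΨL := hΨ0 L
    have e1 : ∀ y : ℝ, 4 * ‖deriv lw 0‖ ^ 2 * ((1 - τ) * y / Ψ L - τ * η L / wormFun η p) =
        τ * (-(4 * ‖deriv lw 0‖ ^ 2 * η L)) / wormFun η p +
          (1 - τ) * (4 * ‖deriv lw 0‖ ^ 2 * y) / Ψ L := by intros; ring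
    rw [e1]
    -- The gradient-square term of the geometric mean has the favourable sign and is dropped; below,
    -- so are `|q2'|²` and the `η''` term.
    refine (sub_le_self _ (by have : 0 < 1 - τ := by linarith
                              positivity)).trans ?_
    gcongr
    have := mul_nonneg (by positivity : 0 ≤ 4 * ‖deriv lw 0‖ ^ 2) (hη2 L)
    nlinarith [sq_nonneg (deriv q2 0).re, sq_nonneg (deriv q2 0).im]

/-! ### Coordinates, and topology and smoothness of the worm domain -/

/-- The point of `ℂ²` with coordinates `a`, `b`. -/
def pt (a b : ℂ) : EuclideanSpace ℂ (Fin 2) := !₂[a, b]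

@[simp] lemma pt_zero (a b : ℂ) : pt a b 0 = a := rfl
@[simp] lemma pt_one (a b : ℂ) : pt a b 1 = b := rfl

lemma pt_eta (p : EuclideanSpace ℂ (Fin 2)) : pt (p 0) (p 1) = p := by
  ext i; fin_cases i <;> rfl

lemma pt_eq (a b : ℂ) :
    pt a b = a • EuclideanSpace.single 0 1 + b • EuclideanSpace.single 1 1 := by
  ext i; fin_cases i <;> simp [pt]

lemma pt_add (a b c d : ℂ) : pt a b + pt c d = pt (a + c) (b + d) := by
  ext i; fin_cases i <;> simp [pt]

lemma smul_pt (a b c : ℂ) : c • pt a b = pt (c * a) (c * b) := by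
  ext i; fin_cases i <;> simp [pt]

lemma real_smul_pt (a b : ℂ) (c : ℝ) : c • pt a b = pt (c * a) (c * b) := by
  ext i; fin_cases i <;> simp [pt]

lemma continuous_pt {X : Type*} [TopologicalSpace X] {f g : X → ℂ} (hf : Continuous f)
    (hg : Continuous g) : Continuous (fun x => pt (f x) (g x)) := by
  simp only [pt_eq]; fun_prop

lemma hasDerivAt_pt {f g : ℝ → ℂ} {f' g' : ℂ} {t : ℝ} (hf : HasDerivAt f f' t)
    (hg : HasDerivAt g g' t) : HasDerivAt (fun t => pt (f t) (g t)) (pt f' g') t := by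
  simp only [pt_eq]
  exact (hf.smul_const _).add (hg.smul_const _)

lemma isOpen_snd_ne_zero : IsOpen {p : EuclideanSpace ℂ (Fin 2) | p 1 ≠ 0} :=
  isOpen_ne_fun (by fun_prop) (by fun_prop)

lemma contDiffOn_logSq {n : WithTop ℕ∞} : ContDiffOn ℝ n logSq {p | p 1 ≠ 0} := by
  have h1 : ContDiff ℝ n (fun p : EuclideanSpace ℂ (Fin 2) => p 1) := by fun_prop
  exact ((h1.norm_sq ℝ).contDiffOn).log fun p hp => by simpa using hp

lemma contDiffOn_wormFun {η : ℝ → ℝ} {n : WithTop ℕ∞} (hη : ContDiff ℝ n η) :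
    ContDiffOn ℝ n (wormFun η) {p | p 1 ≠ 0} := by
  have h0 : ContDiff ℝ n (fun p : EuclideanSpace ℂ (Fin 2) => p 0) := by fun_prop
  have hL := contDiffOn_logSq (n := n)
  have h1 : ContDiffOn ℝ n (fun p => ((logSq p : ℝ) : ℂ)) {p | p 1 ≠ 0} :=
    Complex.ofRealCLM.contDiff.comp_contDiffOn hL
  have h2 : ContDiffOn ℝ n (fun p => p 0 * Complex.exp (-(Complex.I * (logSq p : ℂ))))
      {p | p 1 ≠ 0} := h0.contDiffOn.mul (contDiffOn_const.mul h1).neg.cexp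
  have h3 : ContDiffOn ℝ n (fun p => (p 0 * Complex.exp (-(Complex.I * (logSq p : ℂ)))).re)
      {p | p 1 ≠ 0} := Complex.reCLM.contDiff.comp_contDiffOn h2
  exact ((contDiffOn_const.mul h3).sub (h0.norm_sq ℝ).contDiffOn).sub (hη.comp_contDiffOn hL)

lemma isOpen_wormDomain {η : ℝ → ℝ} (hη : Continuous η) : IsOpen (wormDomain η) := by
  have h := (contDiffOn_wormFun (n := 0) (contDiff_zero.2 hη)).continuousOn.isOpen_inter_preimage
    isOpen_snd_ne_zero (isOpen_Ioi (a := (0:ℝ)))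
  have e : wormDomain η = {p | p 1 ≠ 0} ∩ wormFun η ⁻¹' Ioi 0 := Set.ext fun p => mem_wormDomain
  rwa [e]

lemma logSq_pt_mul_exp (a b : ℂ) (hb : b ≠ 0) (t : ℂ) :
    logSq (pt a (b * Complex.exp t)) = Real.log (‖b‖ ^ 2) + 2 * t.re := by
  have : ‖b‖ ^ 2 ≠ 0 := by simpa using hb
  simp only [logSq, pt_one, norm_mul, mul_pow, Complex.norm_exp]
  rw [Real.log_mul this (by positivity), Real.log_pow (Real.exp _), Real.log_exp]
  simp

lemma norm_expI (L : ℝ) : ‖Complex.exp (Complex.I * (L : ℂ))‖ = 1 := by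
  rw [mul_comm]; exact Complex.norm_exp_ofReal_mul_I L

namespace IsWormProfile

lemma contDiff2 {β : ℝ} {η : ℝ → ℝ} (hw : IsWormProfile β η) :
    ContDiff ℝ 2 η := hw.smooth.of_le (by norm_cast)

lemma deriv2_nonneg {β : ℝ} {η : ℝ → ℝ} (hw : IsWormProfile β η)
    (x : ℝ) : 0 ≤ deriv (deriv η) x := by
  have hd : Differentiable ℝ η := hw.contDiff2.differentiable (by norm_num)
  have h := hw.convex.monotoneOn_deriv (fun x _ => hd x)
  rw [monotoneOn_univ] at h
  exact h.deriv_nonneg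

lemma exists_bound {β : ℝ} {η : ℝ → ℝ} (hw : IsWormProfile β η) :
    ∃ a : ℝ, 0 < a ∧ ∀ x, η x ≤ 1 → |x| ≤ a := by
  obtain ⟨a, ha, h⟩ := hw.large
  refine ⟨a, ha, fun x hx => ?_⟩
  by_contra hc
  rw [not_le, lt_abs] at hc
  refine absurd (h x ?_) (not_lt.2 hx)
  rcases hc with hc | hc
  · exact Or.inr hc
  · left; linarith

lemma eq_zero_iff {β : ℝ} {η : ℝ → ℝ} (hw : IsWormProfile β η)
    {x : ℝ} : η x = 0 ↔ |x| ≤ β - Real.pi / 2 := by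
  have : x ∈ η ⁻¹' {0} ↔ x ∈ Icc (-β + Real.pi / 2) (β - Real.pi / 2) := by rw [hw.zero_set]
  simp only [mem_preimage, mem_singleton_iff, mem_Icc] at this
  rw [this, abs_le]
  constructor <;> rintro ⟨h1, h2⟩ <;> constructor <;> linarith

lemma le_of_abs_le {β : ℝ} {η : ℝ → ℝ} (hw : IsWormProfile β η)
    {x y : ℝ} (h : |x| ≤ |y|) : η x ≤ η y := by
  have he : η (-|y|) = η y := by
    rcases abs_choice y with h | h <;> simp [h, hw.even y]
  have he' : η |y| = η y := by rw [← hw.even |y|, he]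
  have := hw.convex.le_max_of_mem_Icc (x := -|y|) (y := |y|) (z := x) (mem_univ _) (mem_univ _)
    (abs_le.1 h)
  rwa [he, he', max_self] at this

lemma snd_ne_zero_of_mem_closure {β : ℝ} {η : ℝ → ℝ} (hw : IsWormProfile β η)
    {p : EuclideanSpace ℂ (Fin 2)} (hp : p ∈ closure (wormDomain η)) :
    p 1 ≠ 0 ∧ 0 ≤ wormFun η p := by
  obtain ⟨a, ha, hbd⟩ := hw.exists_bound
  have h1 : p 1 ≠ 0 := by
    have hcl : IsClosed {p : EuclideanSpace ℂ (Fin 2) | Real.exp (-a) ≤ ‖p 1‖ ^ 2} :=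
      isClosed_le continuous_const (by fun_prop)
    -- A bound on `|L|` keeps the domain, hence its closure, away from `w = 0`, where `wormFun` is
    -- not smooth.
    have hsub : wormDomain η ⊆ {p : EuclideanSpace ℂ (Fin 2) | Real.exp (-a) ≤ ‖p 1‖ ^ 2} := by
      intro q hq
      rw [mem_wormDomain, wormFun_eq] at hq
      have h2 : η (logSq q) ≤ 1 := by nlinarith [hq.2, sq_nonneg (‖q 0 -
        Complex.exp (Complex.I * (logSq q : ℂ))‖)]
      have h3 := (abs_le.1 (hbd _ h2)).1
      have h4 : 0 < ‖q 1‖ ^ 2 := by have := hq.1; positivity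
      exact (Real.le_log_iff_exp_le h4).1 h3
    have h5 := closure_minimal hsub hcl hp
    intro h0
    have := Real.exp_pos (-a)
    rw [mem_ofPred_eq, h0] at h5
    norm_num at h5
    linarith
  refine ⟨h1, ?_⟩
  have hc : ContinuousAt (wormFun η) p :=
    (contDiffOn_wormFun (n := 0) (contDiff_zero.2 hw.smooth.continuous)).continuousOn.continuousAt
      (isOpen_snd_ne_zero.mem_nhds h1)
  have hfreq := mem_closure_iff_frequently.1 hp
  exact ge_of_tendsto_of_frequently hc (hfreq.mono fun q hq => (mem_wormDomain.1 hq).2.le)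

lemma frontier_subset {β : ℝ} {η : ℝ → ℝ} (hw : IsWormProfile β η)
    {p : EuclideanSpace ℂ (Fin 2)} (hp : p ∈ frontier (wormDomain η)) :
    p 1 ≠ 0 ∧ wormFun η p = 0 := by
  rw [(isOpen_wormDomain hw.smooth.continuous).frontier_eq] at hp
  have h := hw.snd_ne_zero_of_mem_closure hp.1
  refine ⟨h.1, le_antisymm ?_ h.2⟩
  by_contra hc
  exact hp.2 (mem_wormDomain.2 ⟨h.1, not_le.1 hc⟩)

lemma abs_logSq_le_of_mem {η : ℝ → ℝ} {a : ℝ} (ha : ∀ x, η x ≤ 1 → |x| ≤ a) {p : EuclideanSpace ℂ (Fin 2)}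
    (hp : p ∈ wormDomain η) : |logSq p| ≤ a := by
  apply ha
  have := (mem_wormDomain.1 hp).2
  rw [wormFun_eq] at this
  nlinarith [sq_nonneg (‖p 0 - Complex.exp (Complex.I * (logSq p : ℂ))‖)]

lemma isBounded {β : ℝ} {η : ℝ → ℝ} (hw : IsWormProfile β η) :
    Bornology.IsBounded (wormDomain η) := by
  obtain ⟨a, ha, hbd⟩ := hw.exists_bound
  rw [isBounded_iff_forall_norm_le]
  refine ⟨Real.sqrt (2 ^ 2 + Real.exp a), fun p hp => ?_⟩
  have h1 := abs_logSq_le_of_mem hbd hp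
  rw [mem_wormDomain, wormFun_eq] at hp
  rw [EuclideanSpace.norm_eq, Fin.sum_univ_two]
  apply Real.sqrt_le_sqrt
  have h4 : 0 < ‖p 1‖ ^ 2 := by have := hp.1; positivity
  apply add_le_add
  · have h2 := hw.nonneg (logSq p)
    have h3 : ‖p 0 - Complex.exp (Complex.I * (logSq p : ℂ))‖ ≤ 1 := by
      apply le_of_sq_le_sq _ zero_le_one
      linarith [hp.2]
    have h5 := norm_expI (logSq p)
    have h6 : ‖p 0‖ ≤ 2 := by
      have := norm_le_norm_sub_add (p 0) (Complex.exp (Complex.I * (logSq p : ℂ)))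
      linarith
    gcongr
  · exact (Real.log_le_iff_le_exp h4).1 (abs_le.1 h1).2

/-- The domain is a continuous image of a convex set: unit disc, times the interval `η < 1` for `L`,
times the real line for the argument of `w`. The disc over each `w` is rescaled by its radius `√(1 -
η)`. -/
lemma isConnected {β : ℝ} {η : ℝ → ℝ} (hw : IsWormProfile β η)
    (hβ : Real.pi / 2 < β) : IsConnected (wormDomain η) := by
  have hT : Convex ℝ {t : ℝ | η t < 1} := by
    have := hw.convex.convex_lt 1
    simpa using this
  set D : Set (ℂ × ℝ × ℝ) := Metric.ball (0:ℂ) 1 ×ˢ ({t : ℝ | η t < 1} ×ˢ univ) with hD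
  have hconv : Convex ℝ D := (convex_ball _ _).prod (hT.prod convex_univ)
  have h0 : η 0 = 0 := by rw [hw.eq_zero_iff, abs_zero]; linarith
  have hne : D.Nonempty := ⟨(0, 0, 0), by simp [hD, h0]⟩
  set f : ℂ × ℝ × ℝ → EuclideanSpace ℂ (Fin 2) := fun x =>
    pt (Complex.exp (Complex.I * (x.2.1 : ℂ)) + (Real.sqrt (1 - η x.2.1) : ℂ) * x.1)
      (Complex.exp ((x.2.1 / 2 : ℝ) + (x.2.2 : ℂ) * Complex.I)) with hf
  have hfc : Continuous f := by
    have := hw.smooth.continuous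
    apply continuous_pt <;> fun_prop
  have hlog : ∀ x, logSq (f x) = x.2.1 := by
    intro x
    have := logSq_pt_mul_exp (f x 0) 1 one_ne_zero ((x.2.1 / 2 : ℝ) + (x.2.2 : ℂ) * Complex.I)
    simp only [one_mul, norm_one, one_pow, Real.log_one, zero_add] at this
    rw [show f x = pt (f x 0) (Complex.exp ((x.2.1 / 2 : ℝ) + (x.2.2 : ℂ) * Complex.I)) from
      (pt_eta (f x)).symm, this]
    rw [Complex.add_re, Complex.ofReal_re, Complex.re_ofReal_mul, Complex.I_re]
    ring
  have himg : f '' D = wormDomain η := by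
    ext p
    constructor
    · rintro ⟨x, hx, rfl⟩
      rw [mem_wormDomain, wormFun_eq, hlog]
      refine ⟨by simp [hf, Complex.exp_ne_zero], ?_⟩
      have h1 : ‖x.1‖ < 1 := by simpa using hx.1
      have h2 : 0 < 1 - η x.2.1 := sub_pos.2 hx.2.1
      simp only [hf, pt_zero, add_sub_cancel_left, norm_mul, mul_pow, Complex.norm_real,
        Real.norm_eq_abs, sq_abs]
      rw [Real.sq_sqrt h2.le]
      have : ‖x.1‖ ^ 2 < 1 := by
        have := norm_nonneg x.1
        nlinarith
      nlinarith
    · intro hp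
      rw [mem_wormDomain, wormFun_eq] at hp
      have h2 : 0 < 1 - η (logSq p) := by
        nlinarith [hp.2, sq_nonneg (‖p 0 - Complex.exp (Complex.I * (logSq p : ℂ))‖)]
      have h3 := Real.sqrt_pos.2 h2
      refine ⟨((p 0 - Complex.exp (Complex.I * (logSq p : ℂ))) / (Real.sqrt (1 - η (logSq p)) : ℂ),
        logSq p, Complex.arg (p 1)), ⟨?_, sub_pos.1 h2, mem_univ _⟩, ?_⟩
      · rw [mem_ball_zero_iff, norm_div, Complex.norm_real, Real.norm_eq_abs, abs_of_pos h3,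
          div_lt_one h3]
        apply Real.lt_sqrt_of_sq_lt
        linarith [hp.2]
      · conv_rhs => rw [← pt_eta p]
        simp only [hf]
        congr 1
        · rw [mul_div_cancel₀]
          · ring
          · exact_mod_cast h3.ne'
        · have e1 : (logSq p / 2 : ℝ) = Real.log ‖p 1‖ := by
            simp [logSq, Real.log_pow]
          rw [e1]
          have := Complex.exp_log hp.1
          rwa [Complex.log] at this
  rw [← himg]
  exact (hconv.isConnected hne).image f hfc.continuousOn

/-- Moving `z` towards the centre of its disc has derivative `2 ‖c‖²`, so a critical point sits at
the centre, which forces `η = 1`. There, moving along the curve of centres has derivative `-η'`,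
nonzero by the assumption on the profile. -/
lemma fderiv_wormFun_ne_zero {β : ℝ} {η : ℝ → ℝ} (hw : IsWormProfile β η)
    {p : EuclideanSpace ℂ (Fin 2)} (hp : p 1 ≠ 0)
    (h0 : wormFun η p = 0) : fderiv ℝ (wormFun η) p ≠ 0 := by
  intro hz
  have hd : HasFDerivAt (wormFun η) (0 : EuclideanSpace ℂ (Fin 2) →L[ℝ] ℝ) p := by
    rw [← hz]
    exact (((contDiffOn_wormFun hw.contDiff2).differentiableOn (by norm_num)).differentiableAt
      (isOpen_snd_ne_zero.mem_nhds hp)).hasFDerivAt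
  set L := logSq p with hL
  set c : ℂ := Complex.exp (Complex.I * (L : ℂ)) - p 0 with hc
  have hpp : p = pt (p 0) (p 1) := (pt_eta p).symm
  have hlog : ∀ a, logSq (pt a (p 1)) = L := fun a => rfl
  -- the derivative towards the centre of the disc
  have hc0 : c = 0 := by
    have hγ : HasDerivAt (fun t : ℝ => pt (p 0 + (t : ℂ) * c) (p 1)) (pt c 0) 0 := by
      refine hasDerivAt_pt ?_ (hasDerivAt_const _ _)
      simpa using ((hasDerivAt_id (0:ℝ)).ofReal_comp.mul_const c).const_add (p 0)
    have hd' : HasFDerivAt (wormFun η) (0 : EuclideanSpace ℂ (Fin 2) →L[ℝ] ℝ)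
        (pt (p 0 + ((0:ℝ) : ℂ) * c) (p 1)) := by simpa [pt_eta] using hd
    have h1 := hd'.comp_hasDerivAt (0:ℝ) hγ
    have h2 : HasDerivAt (fun t : ℝ => 1 - η L - (1 - t) ^ 2 * ‖c‖ ^ 2) (2 * ‖c‖ ^ 2) 0 := by
      have := ((((hasDerivAt_id (0:ℝ)).const_sub 1).pow 2).mul_const (‖c‖ ^ 2)).const_sub (1 - η L)
      refine this.congr_deriv ?_
      simp
    have h3 : (wormFun η ∘ fun t : ℝ => pt (p 0 + (t : ℂ) * c) (p 1)) =
        fun t : ℝ => 1 - η L - (1 - t) ^ 2 * ‖c‖ ^ 2 := by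
      funext t
      simp only [Function.comp, wormFun_eq, hlog, pt_zero]
      have : p 0 + (t : ℂ) * c - Complex.exp (Complex.I * (L : ℂ)) = ((t - 1 : ℝ) : ℂ) * c := by
        push_cast; rw [hc]; ring
      rw [this, norm_mul, mul_pow, Complex.norm_real, Real.norm_eq_abs, sq_abs]
      ring
    rw [h3] at h1
    have := h1.unique h2
    simpa using this.symm
  have hp0 : p 0 = Complex.exp (Complex.I * (L : ℂ)) := (sub_eq_zero.1 hc0).symm
  have hη1 : η L = 1 := by
    have := wormFun_eq η p
    rw [h0, ← hL, hp0] at this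
    simp at this
    linarith
  -- the derivative along the curve of centres
  have hγ : HasDerivAt (fun t : ℝ => pt (Complex.exp (Complex.I * ((L + t : ℝ) : ℂ)))
      (p 1 * Complex.exp ((t / 2 : ℝ) : ℂ)))
      (pt (Complex.exp (Complex.I * ((L + 0 : ℝ) : ℂ)) * (Complex.I * ((1 : ℝ) : ℂ)))
        (p 1 * (Complex.exp (((0:ℝ) / 2 : ℝ) : ℂ) * ((1 / 2 : ℝ) : ℂ)))) 0 := by
    refine hasDerivAt_pt ?_ ?_
    · exact ((((hasDerivAt_id (0:ℝ)).const_add L).ofReal_comp).const_mul Complex.I).cexp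
    · exact ((((hasDerivAt_id (0:ℝ)).div_const 2).ofReal_comp).cexp).const_mul (p 1)
  have hd' : HasFDerivAt (wormFun η) (0 : EuclideanSpace ℂ (Fin 2) →L[ℝ] ℝ)
      (pt (Complex.exp (Complex.I * ((L + (0:ℝ) : ℝ) : ℂ)))
        (p 1 * Complex.exp (((0:ℝ) / 2 : ℝ) : ℂ))) := by
    simpa [pt_eta, ← hp0] using hd
  have h1 := hd'.comp_hasDerivAt (0:ℝ) hγ
  have h3 : (wormFun η ∘ fun t : ℝ => pt (Complex.exp (Complex.I * ((L + t : ℝ) : ℂ)))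
      (p 1 * Complex.exp ((t / 2 : ℝ) : ℂ))) = fun t : ℝ => 1 - η (L + t) := by
    funext t
    have e : logSq (pt (Complex.exp (Complex.I * ((L + t : ℝ) : ℂ)))
      (p 1 * Complex.exp ((t / 2 : ℝ) : ℂ))) = L + t := by
      rw [logSq_pt_mul_exp _ _ hp, Complex.ofReal_re, hL, logSq]; ring
    rw [Function.comp, wormFun_eq, e, pt_zero]
    simp
  rw [h3] at h1
  have h2 : HasDerivAt (fun t : ℝ => 1 - η (L + t)) (-(deriv η (L + 0))) 0 := by
    have k : HasDerivAt η (deriv η (L + 0)) (L + 0) :=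
      (hw.contDiff2.differentiable (by norm_num) (L + 0)).hasDerivAt
    have := (k.comp_const_add L 0).const_sub 1
    exact this
  have := h1.unique h2
  rw [add_zero] at this
  exact hw.deriv_ne_zero L hη1 (by simpa using this.symm)

lemma exists_smooth_definingFunction {β : ℝ} {η : ℝ → ℝ} (hw : IsWormProfile β η) :
    ∃ r : EuclideanSpace ℂ (Fin 2) → ℝ, IsDefiningFunction ∞ (wormDomain η) r := by
  refine ⟨fun p => -wormFun η p, {p | p 1 ≠ 0}, isOpen_snd_ne_zero,
    fun p hp => (hw.snd_ne_zero_of_mem_closure hp).1, (contDiffOn_wormFun hw.smooth).neg, ?_, ?_⟩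
  · ext p
    rw [mem_wormDomain]; simp
  · intro p hp
    obtain ⟨h1, h2⟩ := hw.frontier_subset hp
    have := hw.fderiv_wormFun_ne_zero h1 h2
    rw [fderiv_fun_neg]
    simpa using this

end IsWormProfile

/-! ### Exponents below `π/(2β)` -/

/-- A smooth concave truncation of the identity. -/
lemma exists_concave_cutoff {c : ℝ} (hc : 0 < c) : ∃ m : ℝ → ℝ, ContDiff ℝ 2 m ∧
    (∀ x, x ≤ c / 2 → m x = x) ∧ (∀ x, 0 ≤ deriv m x) ∧ (∀ x, deriv (deriv m) x ≤ 0) ∧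
    (∀ x, c ≤ x → deriv m x = 0) ∧ ∀ x, 0 < x → 0 < m x := by
  -- The derivative of the truncation: a decreasing step from `1` on `t ≤ c / 2` to `0` on `t ≥ c`.
  set σ : ℝ → ℝ := fun t => Real.smoothTransition ((c - t) / (c / 2)) with hσ
  have hσc : ContDiff ℝ 1 σ := by
    have : ContDiff ℝ 1 Real.smoothTransition := Real.smoothTransition.contDiff
    exact this.comp (by fun_prop)
  set m : ℝ → ℝ := fun x => ∫ t in (0:ℝ)..x, σ t with hm
  have hd : ∀ x, HasDerivAt m (σ x) x := fun x =>
    intervalIntegral.integral_hasDerivAt_right (hσc.continuous.intervalIntegrable _ _)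
      (hσc.continuous.stronglyMeasurableAtFilter _ _) hσc.continuous.continuousAt
  have hdm : deriv m = σ := funext fun x => (hd x).deriv
  have h1 : ∀ t, t ≤ c / 2 → σ t = 1 := fun t ht => by
    apply Real.smoothTransition.one_of_one_le
    rw [le_div_iff₀ (by positivity)]; linarith
  have hid : ∀ x, x ≤ c / 2 → m x = x := by
    intro x hx
    have : ∫ t in (0:ℝ)..x, σ t = ∫ t in (0:ℝ)..x, (1:ℝ) := by
      apply intervalIntegral.integral_congr
      intro t ht
      apply h1
      rcases le_total 0 x with h | h
      · rw [uIcc_of_le h] at ht; exact ht.2.trans hx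
      · rw [uIcc_of_ge h] at ht; linarith [ht.2]
    simp only [hm, this]; simp
  have hmono : Monotone m := monotone_of_deriv_nonneg (fun x => (hd x).differentiableAt)
    (fun x => by rw [hdm]; exact Real.smoothTransition.nonneg _)
  refine ⟨m, ?_, hid, fun x => ?_, fun x => ?_, fun x hx => ?_, fun x hx => ?_⟩
  · rw [show (2 : WithTop ℕ∞) = 1 + 1 by norm_num, contDiff_succ_iff_deriv]
    refine ⟨fun x => (hd x).differentiableAt, by simp, by rwa [hdm]⟩
  · rw [hdm]; exact Real.smoothTransition.nonneg _
  · rw [hdm]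
    apply Antitone.deriv_nonpos
    intro s t hst
    apply Real.smoothTransition.monotone
    gcongr
  · rw [hdm]
    apply Real.smoothTransition.zero_of_nonpos
    apply div_nonpos_of_nonpos_of_nonneg <;> linarith
  · rcases le_total x (c / 2) with h | h
    · rwa [hid x h]
    · have := hmono h
      rw [hid _ le_rfl] at this
      linarith

/-- A positive function equal to `cos (k x)` near the interval `[-l, l]`. -/
lemma exists_pos_cos_extension {k l : ℝ} (hk : 0 < k) (hl : 0 < l) (hkl : k * l < Real.pi / 2) :
    ∃ (Ψ : ℝ → ℝ) (l₁ : ℝ), l < l₁ ∧ ContDiff ℝ 2 Ψ ∧ (∀ x, 0 < Ψ x) ∧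
      ∀ x, |x| < l₁ → deriv (deriv Ψ) x + k ^ 2 * Ψ x = 0 := by
  obtain ⟨l₂, h1, h2⟩ : ∃ l₂, l < l₂ ∧ k * l₂ < Real.pi / 2 := by
    rw [mul_comm, ← lt_div_iff₀ hk] at hkl
    obtain ⟨y, hy1, hy2⟩ := exists_between hkl
    exact ⟨y, hy1, by rwa [lt_div_iff₀ hk, mul_comm] at hy2⟩
  obtain ⟨l₁, h3, h4⟩ := exists_between h1
  let b : ContDiffBump (0:ℝ) := ⟨l₁, l₂, hl.trans h3, h4⟩
  have hcos : ∀ x, |x| < l₂ → 0 < Real.cos (k * x) := by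
    intro x hx
    apply Real.cos_pos_of_mem_Ioo
    rw [abs_lt] at hx
    constructor <;> nlinarith
  refine ⟨fun x => b x * Real.cos (k * x) + (1 - b x), l₁, h3, ?_, fun x => ?_, fun x hx => ?_⟩
  · have hb : ContDiff ℝ 2 b := b.contDiff
    have hc : ContDiff ℝ 2 (fun x : ℝ => Real.cos (k * x)) :=
      Real.contDiff_cos.comp (contDiff_const.mul contDiff_id)
    exact (hb.mul hc).add (contDiff_const.sub hb)
  · beta_reduce
    have hb0 : 0 ≤ b x := b.nonneg
    have hb1 : b x ≤ 1 := b.le_one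
    rcases lt_or_ge |x| l₂ with h | h
    · have := hcos x h
      rcases hb0.eq_or_lt with h0 | h0
      · rw [← h0]; norm_num
      · have := mul_pos h0 this
        linarith
    · have : b x = 0 := b.zero_of_le_dist (by simpa [Real.dist_eq] using h)
      rw [this]; norm_num
  · have hev : ∀ᶠ y in 𝓝 x, b y * Real.cos (k * y) + (1 - b y) = Real.cos (k * y) := by
      have : Metric.ball (0:ℝ) l₁ ∈ 𝓝 x := Metric.isOpen_ball.mem_nhds (by simpa using hx)
      filter_upwards [this] with y hy
      have : b y = 1 := b.one_of_mem_closedBall (Metric.ball_subset_closedBall hy)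
      rw [this]; ring
    have e1 : deriv (fun y => b y * Real.cos (k * y) + (1 - b y)) =ᶠ[𝓝 x]
        deriv (fun y => Real.cos (k * y)) := EventuallyEq.deriv hev
    have e2 : deriv (fun y => Real.cos (k * y)) = fun y => -Real.sin (k * y) * k := by
      funext y
      have := ((hasDerivAt_id y).const_mul k).cos
      simpa using this.deriv
    have e3 : HasDerivAt (fun y => -Real.sin (k * y) * k) (-(Real.cos (k * x) * k) * k) x := by
      have := (((hasDerivAt_id x).const_mul k).sin.neg).mul_const k
      simpa using this
    beta_reduce
    rw [e1.deriv_eq, e2, e3.deriv, hev.self_of_nhds]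
    ring

/-- The Laplacian bound is nonpositive where `|L| < l₁` because `Ψ'' + k² Ψ = 0` and `η ≥ 0`.
Elsewhere `η ≥ ε`, so it is nonpositive as soon as `R` is small. The remaining points are far from
the boundary and are flattened by the truncation `m` of `R^τ Ψ^(1-τ)`. Passing from `m` to `M =
m(x^τ)^(1/τ)` leaves the defining function unchanged near the boundary, so it is still `C²` across
it. -/
theorem isDFExponent_of_deriv2_le {β : ℝ} {η : ℝ → ℝ} (hw : IsWormProfile β η) {τ k l₁ ε : ℝ}
    (hτ0 : 0 < τ) (hτ1 : τ < 1) (hk : k * (1 - τ) = τ) {Ψ : ℝ → ℝ} (hΨ : ContDiff ℝ 2 Ψ)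
    (hΨ0 : ∀ x, 0 < Ψ x) (hΨ2 : ∀ x, |x| < l₁ → deriv (deriv Ψ) x + k ^ 2 * Ψ x = 0)
    (hε : 0 < ε) (hη : ∀ x, l₁ ≤ |x| → ε ≤ η x) : IsDFExponent (wormDomain η) τ := by
  have hτ' : 0 < 1 - τ := by linarith
  have hk0 : 0 < k := pos_of_mul_pos_left (by rwa [hk]) hτ'.le
  obtain ⟨a, ha, hbd⟩ := hw.exists_bound
  -- uniform bounds on the relevant range of `log |w|²`
  have hΨ'' : Continuous (fun x => deriv (deriv Ψ) x + k ^ 2 * Ψ x) := by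
    have h1 : ContDiff ℝ 1 (deriv Ψ) := by
      have : ContDiff ℝ (1 + 1) Ψ := by simpa [one_add_one_eq_two] using hΨ
      exact this.deriv'
    exact (h1.continuous_deriv le_rfl).add (continuous_const.mul hΨ.continuous)
  obtain ⟨C, hC⟩ := (isCompact_Icc (a := -a) (b := a)).bddAbove_image
    (((continuous_const.mul hΨ'').div hΨ.continuous (fun x => (hΨ0 x).ne')).continuousOn
      (f := fun x => (1 - τ) * (deriv (deriv Ψ) x + k ^ 2 * Ψ x) / Ψ x))
  obtain ⟨x₀, -, hx₀⟩ := (isCompact_Icc (a := -a) (b := a)).exists_isMinOn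
    ⟨0, by constructor <;> linarith⟩ hΨ.continuous.continuousOn
  set C' := max C 1 with hC'
  have hC'0 : 0 < C' := lt_of_lt_of_le one_pos (le_max_right _ _)
  -- Chosen so that `R ≤ s` gives `C' R ≤ τ ε`.
  set s := τ * ε / C' with hs
  have hs0 : 0 < s := by positivity
  -- Since `Ψ x₀` is the minimum of `Ψ` on the relevant range, `R^τ Ψ^(1-τ) < c` forces `R ≤ s`.
  set c := s ^ τ * Ψ x₀ ^ (1 - τ) with hc
  have hc0 : 0 < c := mul_pos (Real.rpow_pos_of_pos hs0 _) (Real.rpow_pos_of_pos (hΨ0 _) _)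
  obtain ⟨m, hm, hm1, hm2, hm3, hm4, hm5⟩ := exists_concave_cutoff hc0
  -- the defining function
  set M : ℝ → ℝ := fun x => if x ≤ 0 then x else (m (x ^ τ)) ^ (1 / τ) with hM
  have hMpos : ∀ x, 0 < x → M x = (m (x ^ τ)) ^ (1 / τ) := fun x hx => if_neg (not_le.2 hx)
  set x₁ := (c / 2) ^ (1 / τ) with hx₁
  have hx₁0 : 0 < x₁ := by positivity
  have hMid : ∀ x, x < x₁ → M x = x := by
    intro x hx
    rcases le_or_gt x 0 with h | h
    · exact if_pos h
    · rw [hMpos x h, hm1, ← Real.rpow_mul h.le, mul_one_div_cancel hτ0.ne', Real.rpow_one]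
      have : x ^ τ ≤ x₁ ^ τ := Real.rpow_le_rpow h.le hx.le hτ0.le
      rwa [hx₁, ← Real.rpow_mul (by positivity), one_div_mul_cancel hτ0.ne', Real.rpow_one] at this
  have hM0 : ∀ x, 0 < M x ↔ 0 < x := by
    intro x
    constructor
    · intro h
      by_contra hx
      rw [hMid x (by linarith)] at h
      exact hx h
    · intro h
      rw [hMpos x h]
      exact Real.rpow_pos_of_pos (hm5 _ (Real.rpow_pos_of_pos h _)) _
  have hMc : ContDiff ℝ 2 M := by
    rw [contDiff_iff_contDiffAt]
    intro x
    rcases lt_or_ge x x₁ with h | h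
    · have : M =ᶠ[𝓝 x] id := by
        filter_upwards [gt_mem_nhds h] with y hy using hMid y hy
      exact contDiffAt_id.congr_of_eventuallyEq this
    · have hx : 0 < x := hx₁0.trans_le h
      have : M =ᶠ[𝓝 x] fun x => (m (x ^ τ)) ^ (1 / τ) := by
        filter_upwards [lt_mem_nhds hx] with y hy using hMpos y hy
      refine ContDiffAt.congr_of_eventuallyEq ?_ this
      refine (hm.contDiffAt.comp x (contDiffAt_id.rpow_const_of_ne hx.ne')).rpow_const_of_ne ?_
      exact (hm5 _ (Real.rpow_pos_of_pos hx _)).ne'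
  -- The exponent `1 / k` is forced by `τ / k = 1 - τ`.
  set P : EuclideanSpace ℂ (Fin 2) → ℝ := fun p => wormFun η p * Ψ (logSq p) ^ (1 / k) with hP
  have hΨr : ContDiffOn ℝ 2 (fun p => Ψ (logSq p) ^ (1 / k)) {p | p 1 ≠ 0} :=
    (hΨ.comp_contDiffOn contDiffOn_logSq).rpow_const_of_ne fun p _ => (hΨ0 _).ne'
  have hRc := contDiffOn_wormFun hw.contDiff2
  have hPc : ContDiffOn ℝ 2 P {p | p 1 ≠ 0} := hRc.mul hΨr
  have hPpos : ∀ p, 0 < P p ↔ 0 < wormFun η p := fun p =>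
    mul_pos_iff_of_pos_right (Real.rpow_pos_of_pos (hΨ0 _) _)
  have hPτ : ∀ p, 0 < wormFun η p →
      P p ^ τ = wormFun η p ^ τ * Ψ (logSq p) ^ (1 - τ) := by
    intro p hp
    rw [hP, Real.mul_rpow hp.le (Real.rpow_nonneg (hΨ0 _).le _), ← Real.rpow_mul (hΨ0 _).le]
    congr 2
    field_simp
    linarith
  have hopen := isOpen_wormDomain hw.smooth.continuous
  refine ⟨hτ0, hτ1, fun p => -M (P p), ⟨{p | p 1 ≠ 0}, isOpen_snd_ne_zero,
    fun p hp => (hw.snd_ne_zero_of_mem_closure hp).1, (hMc.comp_contDiffOn hPc).neg, ?_, ?_⟩, ?_⟩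
  · ext p
    rw [mem_wormDomain]
    simp [hM0, hPpos]
  · intro p hp
    obtain ⟨h1, h2⟩ := hw.frontier_subset hp
    have hP0 : P p = 0 := by simp [hP, h2]
    have hn := isOpen_snd_ne_zero.mem_nhds h1
    have hcP : ContinuousAt P p := hPc.continuousOn.continuousAt hn
    have hev : (fun p => -M (P p)) =ᶠ[𝓝 p] fun p => -P p := by
      filter_upwards [hcP.eventually (gt_mem_nhds (hP0 ▸ hx₁0))] with q hq
      rw [hMid _ hq]
    have hdR : DifferentiableAt ℝ (wormFun η) p :=
      (hRc.differentiableOn (by norm_num)).differentiableAt hn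
    have hdΨ : DifferentiableAt ℝ (fun p => Ψ (logSq p) ^ (1 / k)) p :=
      (hΨr.differentiableOn (by norm_num)).differentiableAt hn
    rw [hev.fderiv_eq, fderiv_fun_neg, hP, fderiv_fun_mul hdR hdΨ, h2, zero_smul, zero_add,
      neg_ne_zero]
    exact smul_ne_zero (Real.rpow_pos_of_pos (hΨ0 _) _).ne' (hw.fderiv_wormFun_ne_zero h1 h2)
  · have hueq : ∀ p ∈ wormDomain η, -((- -M (P p)) ^ τ) =
        -m (wormFun η p ^ τ * Ψ (logSq p) ^ (1 - τ)) := by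
      intro p hp
      have h2 := (mem_wormDomain.1 hp).2
      have h3 := (hPpos p).2 h2
      rw [neg_neg, hMpos _ h3, ← Real.rpow_mul (hm5 _ (Real.rpow_pos_of_pos h3 _)).le,
        one_div_mul_cancel hτ0.ne', Real.rpow_one, hPτ p h2]
    have hsub : wormDomain η ⊆ {p | p 1 ≠ 0} := fun p hp => (mem_wormDomain.1 hp).1
    have huc : ContDiffOn ℝ 2 (fun p => -((- -M (P p)) ^ τ)) (wormDomain η) := by
      refine ContDiffOn.neg (ContDiffOn.rpow_const_of_ne
        ((hMc.comp_contDiffOn (hPc.mono hsub)).neg).neg ?_)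
      intro p hp
      simp only [neg_neg]
      exact ((hM0 _).2 ((hPpos p).2 (mem_wormDomain.1 hp).2)).ne'
    refine ⟨huc.continuousOn.upperSemicontinuousOn, fun z v hz =>
      le_circleAverage_of_levi_nonneg hopen huc ?_ z v hz⟩
    intro p hp v
    obtain ⟨hp1, hR⟩ := mem_wormDomain.1 hp
    obtain ⟨gx, gy, Λ, K, hK, hlap, hΛ⟩ := exists_hasLap_wormFun_rpow hw.contDiff2
      hw.deriv2_nonneg hΨ hΨ0 hτ0 hτ1 hk p v hp1 hR
    have hlap2 := (hlap.comp_contDiff hm).const_mul (-1)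
    have heq : (fun ζ : ℂ => (fun p => -((- -M (P p)) ^ τ)) (p + ζ • v)) =ᶠ[𝓝 0] fun ζ => -1 *
        m (wormFun η (p + ζ • v) ^ τ * Ψ (logSq (p + ζ • v)) ^ (1 - τ)) := by
      have hcont : ContinuousAt (fun ζ : ℂ => p + ζ • v) 0 := by fun_prop
      have hmem : ∀ᶠ q in 𝓝 (p + (0:ℂ) • v), q ∈ wormDomain η :=
        hopen.mem_nhds (by simpa using hp)
      filter_upwards [hcont.eventually hmem] with ζ hζ
      beta_reduce
      rw [hueq _ hζ]; ring
    rw [(hlap2.congr heq).levi_eq (huc.contDiffAt (hopen.mem_nhds hp))]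
    set f := wormFun η p ^ τ * Ψ (logSq p) ^ (1 - τ) with hf
    -- Either `m` is flat at `f`, or `f < c` and the sign of `Λ` is controlled. The other term, with
    -- `m'' ≤ 0`, is `key2`.
    have key : deriv m f * Λ ≤ 0 := by
      rcases le_or_gt c f with hcf | hcf
      · rw [hm4 f hcf, zero_mul]
      · refine mul_nonpos_of_nonneg_of_nonpos (hm2 _) (hΛ.trans ?_)
        refine mul_nonpos_of_nonneg_of_nonpos hK ?_
        rw [sub_nonpos]
        rcases lt_or_ge |logSq p| l₁ with hL | hL
        · rw [hΨ2 _ hL, mul_zero, zero_div]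
          have := hw.nonneg (logSq p)
          positivity
        · have hLa := IsWormProfile.abs_logSq_le_of_mem hbd hp
          rw [abs_le] at hLa
          have hmin : Ψ x₀ ≤ Ψ (logSq p) := hx₀ hLa
          have hRs : wormFun η p ≤ s := by
            by_contra hcon
            rw [not_le] at hcon
            refine absurd hcf (not_lt.2 ?_)
            rw [hc, hf]
            have := hΨ0 x₀
            gcongr
          have h1 : (1 - τ) * (deriv (deriv Ψ) (logSq p) + k ^ 2 * Ψ (logSq p)) / Ψ (logSq p) ≤ C' :=
            (hC (mem_image_of_mem _ hLa)).trans (le_max_left _ _)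
          refine h1.trans ?_
          have h2 := hη _ hL
          rw [le_div_iff₀ hR]
          calc C' * wormFun η p ≤ C' * s := by gcongr
            _ = τ * ε := by rw [hs]; field_simp
            _ ≤ τ * η (logSq p) := by gcongr
    have key2 := mul_nonpos_of_nonpos_of_nonneg (hm3 f) (by positivity : 0 ≤ gx ^ 2 + gy ^ 2)
    linarith

/-- With `k = τ / (1 - τ)`, the inequality `k (β - π/2) < π/2` is a rewriting of `2 β τ < π`; this
is where the critical value enters. -/
theorem IsWormProfile.isDFExponent {β : ℝ} {η : ℝ → ℝ} (hw : IsWormProfile β η)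
    (hβ : Real.pi / 2 < β) {τ : ℝ} (hτ0 : 0 < τ) (hτ : τ < Real.pi / (2 * β)) :
    IsDFExponent (wormDomain η) τ := by
  have hpi := Real.pi_pos
  have hβ0 : 0 < β := by linarith
  have hτβ : τ * (2 * β) < Real.pi := (lt_div_iff₀ (by linarith)).1 hτ
  have hτ1 : τ < 1 := by nlinarith
  have hτ' : 0 < 1 - τ := by linarith
  have hk : τ / (1 - τ) * (1 - τ) = τ := div_mul_cancel₀ _ hτ'.ne'
  obtain ⟨Ψ, l₁, hl, hΨ, hΨ0, hΨ2⟩ := exists_pos_cos_extension (k := τ / (1 - τ))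
    (l := β - Real.pi / 2) (by positivity) (by linarith) (by
      rw [div_mul_eq_mul_div, div_lt_iff₀ hτ']; linarith)
  have hl1 : 0 < l₁ := by linarith
  refine isDFExponent_of_deriv2_le hw hτ0 hτ1 hk hΨ hΨ0 hΨ2 (ε := η l₁) ?_ ?_
  · refine lt_of_le_of_ne (hw.nonneg _) (fun h => ?_)
    have := hw.eq_zero_iff.1 h.symm
    rw [abs_of_pos hl1] at this
    linarith
  · intro x hx
    exact hw.le_of_abs_le (by rwa [abs_of_pos hl1])

/-! ### An exponent yields a plurisubharmonic exhaustion -/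

lemma circleIntegrable_comp_disc {E : Type*} [NormedAddCommGroup E] [NormedSpace ℂ E] {S : Set E}
    {φ : E → ℝ} (hφ : ContinuousOn φ S) {z v : E} (hz : ∀ ζ : ℂ, ‖ζ‖ ≤ 1 → z + ζ • v ∈ S) :
    CircleIntegrable (fun ζ : ℂ => φ (z + ζ • v)) 0 1 := by
  have : Continuous (fun θ : ℝ => φ (z + circleMap 0 1 θ • v)) :=
    hφ.comp_continuous (by fun_prop) (fun θ => hz _ (by simp))
  exact this.intervalIntegrable _ _

/-- The exhaustion is `1 / (-ρ)^τ`: the map `g ↦ 1 / g` is convex and decreasing, so it carries the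
super-mean value inequality of `(-ρ)^τ` to a sub-mean value inequality, and it blows up at the
boundary. -/
theorem IsDFExponent.isPseudoconvex {n : ℕ} {Ω : Set (EuclideanSpace ℂ (Fin n))} {τ : ℝ}
    (h : IsDFExponent Ω τ) (hΩ : IsOpen Ω) (hb : Bornology.IsBounded Ω) : IsPseudoconvex Ω := by
  obtain ⟨hτ0, -, ρ, ⟨U, hU, hUc, hρ, hΩρ, -⟩, -, hsub⟩ := h
  have hneg : ∀ p ∈ Ω, 0 < -ρ p := fun p hp => by
    rw [hΩρ] at hp; linarith [hp.2]
  have hpos : ∀ p ∈ Ω, 0 < (-ρ p) ^ τ := fun p hp => Real.rpow_pos_of_pos (hneg p hp) _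
  have hc : ContinuousOn (fun p => (-ρ p) ^ τ) Ω :=
    ((hρ.continuousOn.mono (subset_closure.trans hUc)).neg).rpow_const
      (fun p hp => Or.inl (hneg p hp).ne')
  have hφ : ContinuousOn (fun p => ((-ρ p) ^ τ)⁻¹) Ω := hc.inv₀ fun p hp => (hpos p hp).ne'
  refine ⟨hΩ, fun p => ((-ρ p) ^ τ)⁻¹, hφ, ⟨hφ.upperSemicontinuousOn, fun z v hz => ?_⟩, ?_⟩
  · have hi := circleIntegrable_comp_disc hφ hz
    refine ⟨hi, ?_⟩
    have hz0 : z ∈ Ω := by simpa using hz 0 (by simp)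
    obtain ⟨-, h2⟩ := hsub z v hz
    have hic := circleIntegrable_comp_disc hc hz
    have h3 : Real.circleAverage (fun ζ : ℂ => -(-ρ (z + ζ • v)) ^ τ) 0 1 =
        -Real.circleAverage (fun ζ : ℂ => (-ρ (z + ζ • v)) ^ τ) 0 1 := by
      simp [Real.circleAverage]
    rw [h3] at h2
    set g₀ := (-ρ z) ^ τ with hg₀
    have hg₀0 : 0 < g₀ := hpos z hz0
    -- The integrand is the tangent line of `g ↦ 1 / g` at `g₀`, which lies below the graph.
    have hil : CircleIntegrable (fun ζ : ℂ => 2 / g₀ - (1 / g₀ ^ 2) • (-ρ (z + ζ • v)) ^ τ) 0 1 :=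
      (circleIntegrable_const _ _ _).sub (hic.const_fun_smul (a := 1 / g₀ ^ 2))
    have hmono : Real.circleAverage
        (fun ζ : ℂ => 2 / g₀ - (1 / g₀ ^ 2) • (-ρ (z + ζ • v)) ^ τ) 0 1 ≤
        Real.circleAverage (fun ζ : ℂ => ((-ρ (z + ζ • v)) ^ τ)⁻¹) 0 1 := by
      apply Real.circleAverage_mono hil hi
      intro ζ hζ
      have hg := hpos _ (hz ζ (by simpa using (mem_sphere_zero_iff_norm.1 hζ).le))
      generalize (-ρ (z + ζ • v)) ^ τ = g at hg
      rw [smul_eq_mul, sub_le_iff_le_add, ← sub_nonneg]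
      have : g⁻¹ + 1 / g₀ ^ 2 * g - 2 / g₀ = (g - g₀) ^ 2 / (g * g₀ ^ 2) := by
        field_simp; ring
      rw [this]; positivity
    refine le_trans ?_ hmono
    rw [Real.circleAverage_fun_sub (circleIntegrable_const _ _ _)
      (hic.const_fun_smul (a := 1 / g₀ ^ 2)), Real.circleAverage_const,
      Real.circleAverage_fun_smul, smul_eq_mul]
    have : 1 / g₀ ^ 2 * Real.circleAverage (fun ζ : ℂ => (-ρ (z + ζ • v)) ^ τ) 0 1 ≤
        1 / g₀ ^ 2 * g₀ := by
      gcongr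
      linarith
    have e : 1 / g₀ ^ 2 * g₀ = 1 / g₀ := by field_simp
    have e2 : 2 / g₀ = 1 / g₀ + 1 / g₀ := by ring
    change g₀⁻¹ ≤ _
    rw [inv_eq_one_div]
    linarith
  · intro c
    rcases le_or_gt c 0 with hc0 | hc0
    · convert isCompact_empty
      ext p
      simp only [mem_ofPred_eq, mem_empty_iff_false, iff_false, not_and, not_le]
      intro hp
      exact hc0.trans_lt (inv_pos.2 (hpos p hp))
    · have e : {z | z ∈ Ω ∧ ((-ρ z) ^ τ)⁻¹ ≤ c} =
          closure Ω ∩ ρ ⁻¹' Iic (-(c⁻¹ ^ τ⁻¹)) := by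
        ext p
        have key : p ∈ Ω → (((-ρ p) ^ τ)⁻¹ ≤ c ↔ ρ p ≤ -(c⁻¹ ^ τ⁻¹)) := by
          intro hp
          rw [inv_le_comm₀ (hpos p hp) hc0, ← Real.rpow_inv_le_iff_of_pos (by positivity)
            (hneg p hp).le hτ0, le_neg]
        constructor
        · rintro ⟨h1, h2⟩
          exact ⟨subset_closure h1, (key h1).1 h2⟩
        · rintro ⟨h1, h2⟩
          have h3 : p ∈ Ω := by
            rw [hΩρ]
            refine ⟨hUc h1, lt_of_le_of_lt h2 ?_⟩
            have : 0 < c⁻¹ ^ τ⁻¹ := by positivity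
            linarith
          exact ⟨h3, (key h3).2 h2⟩
      rw [e]
      refine Metric.isCompact_of_isClosed_isBounded ?_ (hb.closure.subset inter_subset_left)
      exact (hρ.continuousOn.mono hUc).preimage_isClosed_of_isClosed isClosed_closure isClosed_Iic

/-! ### Strict sub-mean value property on small circles -/

lemma hasJet2_norm_sq (p v : ℂ) :
    HasJet2 (fun t : ℝ => ‖p + t • v‖ ^ 2) (‖p‖ ^ 2) (2 * (p.re * v.re + p.im * v.im))
      (2 * ‖v‖ ^ 2) := by
  have e : (fun t : ℝ => ‖p + t • v‖ ^ 2) =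
      fun t : ℝ => ‖p‖ ^ 2 + t * (2 * (p.re * v.re + p.im * v.im)) + t ^ 2 * ‖v‖ ^ 2 := by
    funext t
    simp only [← Complex.normSq_eq_norm_sq, Complex.normSq_apply, Complex.add_re, Complex.add_im,
      Complex.real_smul, Complex.re_ofReal_mul, Complex.im_ofReal_mul]
    ring
  rw [e]
  refine ⟨fun t => 2 * (p.re * v.re + p.im * v.im) + 2 * t * ‖v‖ ^ 2, Eventually.of_forall
    fun t => ?_, ?_, by simp, by simp⟩
  · have := ((((hasDerivAt_id t).mul_const (2 * (p.re * v.re + p.im * v.im))).const_add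
      (‖p‖ ^ 2))).add (((hasDerivAt_id t).pow 2).mul_const (‖v‖ ^ 2))
    refine this.congr_deriv ?_
    simp
  · have := (((hasDerivAt_id (0:ℝ)).const_mul 2).mul_const (‖v‖ ^ 2)).const_add
      (2 * (p.re * v.re + p.im * v.im))
    refine this.congr_deriv ?_
    simp

/-- A `C²` function with positive Laplacian at `0` has a strict sub-mean value property on small
circles. -/
theorem HasLap.lt_circleAverage {F : ℂ → ℝ} (hF : ContDiffAt ℝ 2 F 0) {c gx gy Λ : ℝ}
    (h : HasLap F c gx gy Λ) (hΛ : 0 < Λ) :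
    ∃ δ > 0, ∀ ε : ℝ, 0 < ε → ε < δ →
      F 0 < Real.circleAverage (fun ζ : ℂ => F (0 + ζ • (ε : ℂ))) 0 1 := by
  set Q : ℂ → ℝ := fun p => fderiv ℝ (fderiv ℝ F) p 1 1 +
    fderiv ℝ (fderiv ℝ F) p Complex.I Complex.I with hQ
  have hQ0 : Q 0 = Λ := by
    have := HasLap.levi_eq (v := (1:ℂ)) hF (h.congr (by simp))
    simpa using this
  have hQc : ContinuousAt Q 0 := by
    have h1 : ContDiffAt ℝ 1 (fderiv ℝ F) 0 := hF.fderiv_right (by norm_num)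
    have h2 : ContDiffAt ℝ 0 (fderiv ℝ (fderiv ℝ F)) 0 := h1.fderiv_right (by norm_num)
    have h3 := h2.continuousAt
    exact ((h3.clm_apply continuousAt_const).clm_apply continuousAt_const).add
      ((h3.clm_apply continuousAt_const).clm_apply continuousAt_const)
  have hev : ∀ᶠ p in 𝓝 (0:ℂ), ContDiffAt ℝ 2 F p ∧ Λ / 2 < Q p :=
    (hF.eventually (by simp)).and (hQc.eventually (lt_mem_nhds (by rw [hQ0]; linarith)))
  obtain ⟨δ, hδ, hball⟩ := Metric.eventually_nhds_iff_ball.1 hev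
  refine ⟨δ, hδ, fun ε hε0 hεδ => ?_⟩
  -- The correction has Laplacian `-Λ / 2`, and that of `F` exceeds `Λ / 2` near `0`, so `u` is
  -- still subharmonic; its sub-mean inequality gives `F` the gain `(Λ / 8) ε²`.
  set u : ℂ → ℝ := fun p => F p + (-(Λ / 8)) * ‖p‖ ^ 2 with hu
  have hFc : ContDiffOn ℝ 2 F (Metric.ball 0 δ) := fun p hp => (hball p hp).1.contDiffWithinAt
  have huc : ContDiffOn ℝ 2 u (Metric.ball 0 δ) :=
    hFc.add (contDiffOn_const.mul (contDiff_norm_sq ℝ).contDiffOn)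
  have hlevi : ∀ p ∈ Metric.ball (0:ℂ) δ, ∀ v : ℂ, fderiv ℝ (fderiv ℝ u) p v v =
      fderiv ℝ (fderiv ℝ F) p v v - Λ / 4 * ‖v‖ ^ 2 := by
    intro p hp v
    have h1 := (HasJet2.const (-(Λ / 8))).mul (hasJet2_norm_sq p v)
    have h2 := (HasJet2.of_contDiffAt (hball p hp).1 v).add h1
    rw [h2.fderiv_fderiv_eq (u := u) (huc.contDiffAt (Metric.isOpen_ball.mem_nhds hp))]
    ring
  have hdisc : ∀ ζ : ℂ, ‖ζ‖ ≤ 1 → 0 + ζ • (ε : ℂ) ∈ Metric.ball (0:ℂ) δ := by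
    intro ζ hζ
    rw [mem_ball_zero_iff, zero_add, norm_smul, Complex.norm_real, Real.norm_eq_abs,
      abs_of_pos hε0]
    nlinarith
  have key := (le_circleAverage_of_levi_nonneg Metric.isOpen_ball huc ?_ 0 (ε : ℂ) hdisc).2
  · have e1 : Real.circleAverage (fun ζ : ℂ => u (0 + ζ • (ε : ℂ))) 0 1 =
        Real.circleAverage (fun ζ : ℂ => F (0 + ζ • (ε : ℂ)) + (-(Λ / 8)) * ε ^ 2) 0 1 := by
      apply Real.circleAverage_congr_sphere
      intro ζ hζ
      have : ‖ζ‖ = 1 := by simpa using hζ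
      simp [hu, this]
    rw [e1, Real.circleAverage_fun_add (circleIntegrable_comp_disc hFc.continuousOn hdisc)
      (circleIntegrable_const _ _ _), Real.circleAverage_const] at key
    simp only [hu, norm_zero] at key
    have : 0 < Λ / 8 * ε ^ 2 := by positivity
    linarith
  · intro p hp v
    rw [hlevi p hp, hlevi p hp]
    have e1 : v = v.re • (1:ℂ) + v.im • Complex.I := by
      simp
    have e2 : Complex.I • v = v.re • Complex.I + (-v.im) • (1:ℂ) := by
      apply Complex.ext <;> simp
    have e3 : fderiv ℝ (fderiv ℝ F) p v v +
        fderiv ℝ (fderiv ℝ F) p (Complex.I • v) (Complex.I • v) = ‖v‖ ^ 2 * Q p := by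
      have e0 : ‖v‖ ^ 2 = v.re ^ 2 + v.im ^ 2 := by
        rw [← Complex.normSq_eq_norm_sq, Complex.normSq_apply]; ring
      rw [e2, e0]
      simp only [hQ]
      generalize fderiv ℝ (fderiv ℝ F) p = B
      generalize v.re = x at e1
      generalize v.im = y at e1
      subst e1
      simp only [map_add, map_smul, _root_.add_apply, _root_.smul_apply, smul_eq_mul]
      ring
    have e4 : ‖Complex.I • v‖ = ‖v‖ := by simp
    rw [e4]
    have := mul_le_mul_of_nonneg_left (hball p hp).2.le (sq_nonneg ‖v‖)
    linarith

/-! ### First-order behaviour of a defining function along the annulus `z = 0` -/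

lemma logSq_pt (a b : ℂ) : logSq (pt a b) = logSq (pt 0 b) := rfl

lemma wormFun_pt_of_eq_zero {η : ℝ → ℝ} {z w : ℂ} (h : η (logSq (pt 0 w)) = 0) :
    wormFun η (pt z w) =
      1 - ‖z - Complex.exp (Complex.I * (logSq (pt 0 w) : ℂ))‖ ^ 2 := by
  rw [wormFun_eq, logSq_pt, h, pt_zero, sub_zero]

lemma mem_closure_wormDomain {η : ℝ → ℝ} {z w : ℂ} (hw0 : w ≠ 0) (h : η (logSq (pt 0 w)) = 0)
    (hz : ‖z - Complex.exp (Complex.I * (logSq (pt 0 w) : ℂ))‖ ≤ 1) :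
    pt z w ∈ closure (wormDomain η) := by
  set N := Complex.exp (Complex.I * (logSq (pt 0 w) : ℂ)) with hN
  have hc : Continuous (fun t : ℝ => pt (N + (t : ℂ) * (z - N)) w) :=
    continuous_pt (by fun_prop) (by fun_prop)
  have ht : Tendsto (fun t : ℝ => pt (N + (t : ℂ) * (z - N)) w) (𝓝[<] 1) (𝓝 (pt z w)) := by
    have := (hc.tendsto 1).mono_left (nhdsWithin_le_nhds (s := Iio 1))
    simpa using this
  refine mem_closure_of_tendsto ht ?_
  filter_upwards [Ioo_mem_nhdsLT (zero_lt_one' ℝ)] with t ht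
  rw [mem_wormDomain, wormFun_pt_of_eq_zero h, add_sub_cancel_left, norm_mul, Complex.norm_real,
    Real.norm_eq_abs, abs_of_pos ht.1]
  refine ⟨hw0, ?_⟩
  have h1 : t * ‖z - N‖ < 1 := by nlinarith [ht.1, ht.2, norm_nonneg (z - N)]
  have h2 : 0 ≤ t * ‖z - N‖ := mul_nonneg ht.1.le (norm_nonneg _)
  nlinarith

lemma eq_zero_of_mem_closure_of_notMem {E : Type*} [TopologicalSpace E] {Ω U : Set E} {ρ : E → ℝ}
    (hU : IsOpen U) (hUc : closure Ω ⊆ U) (hρ : ContinuousOn ρ U) (hΩ : Ω = {z | z ∈ U ∧ ρ z < 0})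
    {p : E} (hp : p ∈ closure Ω) (hp' : p ∉ Ω) : ρ p = 0 := by
  apply le_antisymm
  · have hc : ContinuousAt ρ p := hρ.continuousAt (hU.mem_nhds (hUc hp))
    refine le_of_tendsto_of_frequently hc ((mem_closure_iff_frequently.1 hp).mono fun q hq => ?_)
    rw [hΩ] at hq
    exact hq.2.le
  · by_contra hcon
    apply hp'
    rw [hΩ]
    exact ⟨hUc hp, not_le.1 hcon⟩

section DefiningFunction

variable {β : ℝ} {η : ℝ → ℝ} {U : Set (EuclideanSpace ℂ (Fin 2))}
  {ρ : EuclideanSpace ℂ (Fin 2) → ℝ}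

lemma eq_zero_of_norm_eq_one (hU : IsOpen U) (hUc : closure (wormDomain η) ⊆ U)
    (hρ : ContDiffOn ℝ 2 ρ U) (hΩ : wormDomain η = {z | z ∈ U ∧ ρ z < 0}) {z w : ℂ} (hw0 : w ≠ 0)
    (h : η (logSq (pt 0 w)) = 0)
    (hz : ‖z - Complex.exp (Complex.I * (logSq (pt 0 w) : ℂ))‖ = 1) : ρ (pt z w) = 0 := by
  refine eq_zero_of_mem_closure_of_notMem hU hUc hρ.continuousOn hΩ
    (mem_closure_wormDomain hw0 h hz.le) ?_
  rw [mem_wormDomain, wormFun_pt_of_eq_zero h, hz]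
  norm_num

lemma eq_zero_of_fst_eq_zero (hU : IsOpen U) (hUc : closure (wormDomain η) ⊆ U)
    (hρ : ContDiffOn ℝ 2 ρ U) (hΩ : wormDomain η = {z | z ∈ U ∧ ρ z < 0}) {w : ℂ} (hw0 : w ≠ 0)
    (h : η (logSq (pt 0 w)) = 0) : ρ (pt 0 w) = 0 :=
  eq_zero_of_norm_eq_one hU hUc hρ hΩ hw0 h (by rw [zero_sub, norm_neg, norm_expI])

/-- The inner normal derivative of a defining function along the annulus `z = 0`. -/
def normalDeriv (ρ : EuclideanSpace ℂ (Fin 2) → ℝ) (w : ℂ) : ℝ :=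
  -fderiv ℝ ρ (pt 0 w) (pt (Complex.exp (Complex.I * (logSq (pt 0 w) : ℂ))) 0)

lemma mem_of_fst_eq_zero (hUc : closure (wormDomain η) ⊆ U) {w : ℂ} (hw0 : w ≠ 0)
    (h : η (logSq (pt 0 w)) = 0) : pt 0 w ∈ U :=
  hUc (mem_closure_wormDomain hw0 h (by rw [zero_sub, norm_neg, norm_expI]))

/-- Where `η = 0`, the fibre over `w` is a unit disc whose boundary circle passes through `z = 0`
and lies in the zero set of `ρ`. The derivative along the tangent `I N` therefore vanishes, and only
the component of `z` along `N` counts. -/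
lemma fderiv_pt_zero (hU : IsOpen U) (hUc : closure (wormDomain η) ⊆ U)
    (hρ : ContDiffOn ℝ 2 ρ U) (hΩ : wormDomain η = {z | z ∈ U ∧ ρ z < 0}) {w : ℂ} (hw0 : w ≠ 0)
    (h : η (logSq (pt 0 w)) = 0) (z : ℂ) :
    -fderiv ℝ ρ (pt 0 w) (pt z 0) =
      normalDeriv ρ w * (z * Complex.exp (-(Complex.I * (logSq (pt 0 w) : ℂ)))).re := by
  set N := Complex.exp (Complex.I * (logSq (pt 0 w) : ℂ)) with hN
  have hd : HasFDerivAt ρ (fderiv ℝ ρ (pt 0 w)) (pt 0 w) :=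
    ((hρ.differentiableOn (by norm_num)).differentiableAt
      (hU.mem_nhds (mem_of_fst_eq_zero hUc hw0 h))).hasFDerivAt
  have htan : fderiv ℝ ρ (pt 0 w) (pt (Complex.I * N) 0) = 0 := by
    have hγ : HasDerivAt (fun t : ℝ => pt (N * (1 - Complex.exp (-(t * Complex.I)))) w)
        (pt (Complex.I * N) 0) 0 := by
      refine hasDerivAt_pt ?_ (hasDerivAt_const _ _)
      have := (((((hasDerivAt_id (0:ℝ)).ofReal_comp.mul_const Complex.I).neg).cexp).const_sub
        1).const_mul N
      refine this.congr_deriv ?_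
      simp [mul_comm]
    have hd' : HasFDerivAt ρ (fderiv ℝ ρ (pt 0 w))
        (pt (N * (1 - Complex.exp (-(((0:ℝ) : ℂ) * Complex.I)))) w) := by simpa using hd
    have h1 := hd'.comp_hasDerivAt (0:ℝ) hγ
    have h2 : (ρ ∘ fun t : ℝ => pt (N * (1 - Complex.exp (-(t * Complex.I)))) w) = fun _ => 0 := by
      funext t
      refine eq_zero_of_norm_eq_one hU hUc hρ hΩ hw0 h ?_
      rw [← hN, show N * (1 - Complex.exp (-(t * Complex.I))) - N =
        -(N * Complex.exp (((-t : ℝ) : ℂ) * Complex.I)) by push_cast; ring_nf, norm_neg, norm_mul,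
        Complex.norm_exp_ofReal_mul_I, norm_expI, one_mul]
    rw [h2] at h1
    exact h1.unique (hasDerivAt_const _ _)
  have hz : pt z 0 = (z * Complex.exp (-(Complex.I * (logSq (pt 0 w) : ℂ)))).re • pt N 0 +
      (z * Complex.exp (-(Complex.I * (logSq (pt 0 w) : ℂ)))).im • pt (Complex.I * N) 0 := by
    rw [real_smul_pt, real_smul_pt, pt_add]
    congr 1
    · have e := Complex.re_add_im (z * Complex.exp (-(Complex.I * (logSq (pt 0 w) : ℂ))))
      have e2 : Complex.exp (-(Complex.I * (logSq (pt 0 w) : ℂ))) * N = 1 := by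
        rw [hN, ← Complex.exp_add]; simp
      linear_combination (-z) * e2 - N * e
    · simp
  rw [hz, map_add, map_smul, map_smul, htan, normalDeriv]
  simp only [smul_eq_mul]
  ring

/-- The inward ray enters the domain, so the derivative is nonnegative. If it were zero, the whole
gradient would vanish: the `z` directions by `fderiv_pt_zero`, the `w` directions because `ρ` is
zero on the open annulus. -/
lemma normalDeriv_pos (hw : IsWormProfile β η) (hU : IsOpen U)
    (hUc : closure (wormDomain η) ⊆ U) (hρ : ContDiffOn ℝ 2 ρ U)
    (hΩ : wormDomain η = {z | z ∈ U ∧ ρ z < 0})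
    (hgrad : ∀ z ∈ frontier (wormDomain η), fderiv ℝ ρ z ≠ 0) {w : ℂ} (hw0 : w ≠ 0)
    (h : |logSq (pt 0 w)| < β - Real.pi / 2) : 0 < normalDeriv ρ w := by
  have hη := hw.eq_zero_iff.2 h.le
  set N := Complex.exp (Complex.I * (logSq (pt 0 w) : ℂ)) with hN
  have hd : HasFDerivAt ρ (fderiv ℝ ρ (pt 0 w)) (pt 0 w) :=
    ((hρ.differentiableOn (by norm_num)).differentiableAt
      (hU.mem_nhds (mem_of_fst_eq_zero hUc hw0 hη))).hasFDerivAt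
  have hd' : HasFDerivAt ρ (fderiv ℝ ρ (pt 0 w)) (pt (((0:ℝ) : ℂ) * N) w) := by simpa using hd
  have hnn : 0 ≤ normalDeriv ρ w := by
    have hγ : HasDerivAt (fun t : ℝ => pt ((t : ℂ) * N) w) (pt N 0) 0 := by
      refine hasDerivAt_pt ?_ (hasDerivAt_const _ _)
      simpa using ((hasDerivAt_id (0:ℝ)).ofReal_comp.mul_const N)
    have h1 := (hd'.comp_hasDerivAt (0:ℝ) hγ).tendsto_slope_zero_right
    rw [normalDeriv, Left.nonneg_neg_iff]
    refine le_of_tendsto h1 ?_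
    filter_upwards [Ioo_mem_nhdsGT (zero_lt_one' ℝ)] with t ht
    have h2 : pt ((t : ℂ) * N) w ∈ wormDomain η := by
      rw [mem_wormDomain, wormFun_pt_of_eq_zero hη, ← hN, show (t : ℂ) * N - N =
        ((t - 1 : ℝ) : ℂ) * N by push_cast; ring, norm_mul, norm_expI, mul_one, Complex.norm_real,
        Real.norm_eq_abs, sq_abs]
      refine ⟨hw0, ?_⟩
      nlinarith [ht.1, ht.2]
    rw [hΩ] at h2
    have h3 : ρ (pt 0 w) = 0 := eq_zero_of_fst_eq_zero hU hUc hρ hΩ hw0 hη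
    simp only [Function.comp, zero_add, Complex.ofReal_zero, zero_mul, h3, sub_zero, smul_eq_mul]
    exact mul_nonpos_of_nonneg_of_nonpos (inv_nonneg.2 ht.1.le) h2.2.le
  refine lt_of_le_of_ne hnn fun h0 => ?_
  have hfr : pt 0 w ∈ frontier (wormDomain η) := by
    rw [(isOpen_wormDomain hw.smooth.continuous).frontier_eq]
    refine ⟨mem_closure_wormDomain hw0 hη (by rw [zero_sub, norm_neg, norm_expI]), ?_⟩
    rw [mem_wormDomain, wormFun_pt_of_eq_zero hη, zero_sub, norm_neg, norm_expI]
    norm_num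
  apply hgrad _ hfr
  ext p
  have hz : fderiv ℝ ρ (pt 0 w) (pt (p 0) 0) = 0 := by
    have := fderiv_pt_zero hU hUc hρ hΩ hw0 hη (p 0)
    rw [← h0, zero_mul] at this
    linarith
  have hv : fderiv ℝ ρ (pt 0 w) (pt 0 (p 1)) = 0 := by
    have hγ : HasDerivAt (fun t : ℝ => pt 0 (w + (t : ℂ) * p 1)) (pt 0 (p 1)) 0 := by
      refine hasDerivAt_pt (hasDerivAt_const _ _) ?_
      simpa using ((hasDerivAt_id (0:ℝ)).ofReal_comp.mul_const (p 1)).const_add w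
    have hd2 : HasFDerivAt ρ (fderiv ℝ ρ (pt 0 w)) (pt 0 (w + ((0:ℝ) : ℂ) * p 1)) := by
      simpa using hd
    have h1 := hd2.comp_hasDerivAt (0:ℝ) hγ
    have hev : (ρ ∘ fun t : ℝ => pt 0 (w + (t : ℂ) * p 1)) =ᶠ[𝓝 0] fun _ => 0 := by
      have hcL : ContinuousAt logSq (pt 0 w) :=
        (contDiffOn_logSq (n := 0)).continuousOn.continuousAt (isOpen_snd_ne_zero.mem_nhds hw0)
      have hev1 : ∀ᶠ q in 𝓝 (pt 0 w), q 1 ≠ 0 ∧ |logSq q| < β - Real.pi / 2 :=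
        (isOpen_snd_ne_zero.eventually_mem (x := pt 0 w) hw0).and
          (hcL.abs.eventually (gt_mem_nhds h))
      have ht : Tendsto (fun t : ℝ => pt 0 (w + (t : ℂ) * p 1)) (𝓝 0) (𝓝 (pt 0 w)) := by
        have := hγ.continuousAt.tendsto; simpa using this
      filter_upwards [ht.eventually hev1] with t htt
      exact eq_zero_of_fst_eq_zero hU hUc hρ hΩ htt.1 (hw.eq_zero_iff.2 htt.2.le)
    exact h1.unique ((hasDerivAt_const (0:ℝ) (0:ℝ)).congr_of_eventuallyEq hev)
  have : p = pt (p 0) 0 + pt 0 (p 1) := by rw [pt_add, add_zero, zero_add, pt_eta]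
  rw [this, map_add, hz, hv]
  simp

end DefiningFunction

/-! ### Blow-up of `(-ρ)^τ` at the annulus -/

/-- Apply plurisubharmonicity on the disc with `z` scaled by `δ`, multiply by `δ^(-τ)` and let `δ →
0`. As `ρ` vanishes on `z = 0`, the quotients `-ρ / δ` tend to the derivative in the direction `z`,
and a Lipschitz bound permits dominated convergence. The hypothesis `hre` makes the scaled discs
enter the domain. -/
theorem circleAverage_fderiv_rpow_le {β : ℝ} {η : ℝ → ℝ} (hw : IsWormProfile β η)
    {U : Set (EuclideanSpace ℂ (Fin 2))} {ρ : EuclideanSpace ℂ (Fin 2) → ℝ} (hU : IsOpen U)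
    (hUc : closure (wormDomain η) ⊆ U) (hρ : ContDiffOn ℝ 2 ρ U)
    (hΩ : wormDomain η = {z | z ∈ U ∧ ρ z < 0}) {τ : ℝ} (hτ0 : 0 < τ)
    (hpsh : IsPlurisubharmonicOn (fun z => -((-ρ z) ^ τ)) (wormDomain η)) (z₀ a w₀ b : ℂ)
    (hw0 : ∀ ζ : ℂ, ‖ζ‖ ≤ 1 → w₀ + ζ * b ≠ 0)
    (hη : ∀ ζ : ℂ, ‖ζ‖ ≤ 1 → η (logSq (pt 0 (w₀ + ζ * b))) = 0)
    (hre : ∀ ζ : ℂ, ‖ζ‖ ≤ 1 → 0 < ((z₀ + ζ * a) *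
      Complex.exp (-(Complex.I * (logSq (pt 0 (w₀ + ζ * b)) : ℂ)))).re) :
    Real.circleAverage (fun ζ : ℂ =>
      (-fderiv ℝ ρ (pt 0 (w₀ + ζ * b)) (pt (z₀ + ζ * a) 0)) ^ τ) 0 1 ≤
        (-fderiv ℝ ρ (pt 0 w₀) (pt z₀ 0)) ^ τ := by
  set D : Set ℂ := Metric.closedBall 0 1 with hD
  have hmD : ∀ {ζ : ℂ}, ζ ∈ D ↔ ‖ζ‖ ≤ 1 := by intro ζ; simp [hD]
  have hDc : IsCompact D := isCompact_closedBall 0 1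
  have hLc : ContinuousOn (fun ζ : ℂ => logSq (pt 0 (w₀ + ζ * b))) D := by
    refine (contDiffOn_logSq (n := 0)).continuousOn.comp
      (continuous_pt continuous_const (by fun_prop)).continuousOn fun ζ hζ => ?_
    exact hw0 ζ (hmD.1 hζ)
  have hXc : ContinuousOn (fun ζ : ℂ => ((z₀ + ζ * a) *
      Complex.exp (-(Complex.I * (logSq (pt 0 (w₀ + ζ * b)) : ℂ)))).re) D := by
    have h1 : ContinuousOn (fun ζ : ℂ => ((logSq (pt 0 (w₀ + ζ * b)) : ℝ) : ℂ)) D :=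
      Complex.continuous_ofReal.comp_continuousOn hLc
    have h2 : ContinuousOn (fun ζ : ℂ => (z₀ + ζ * a)) D := by fun_prop
    exact Complex.continuous_re.comp_continuousOn
      (h2.mul (Complex.continuous_exp.comp_continuousOn (continuousOn_const.mul h1).neg))
  obtain ⟨ζ₁, hζ₁, hmin⟩ := hDc.exists_isMinOn ⟨0, by simp [hD]⟩ hXc
  set μ := ((z₀ + ζ₁ * a) *
      Complex.exp (-(Complex.I * (logSq (pt 0 (w₀ + ζ₁ * b)) : ℂ)))).re with hμ
  have hμ0 : 0 < μ := hre ζ₁ (hmD.1 hζ₁)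
  set B := ‖z₀‖ + ‖a‖ with hB
  have hB0 : 0 ≤ B := by positivity
  have hzB : ∀ ζ ∈ D, ‖z₀ + ζ * a‖ ≤ B := by
    intro ζ hζ
    refine (norm_add_le _ _).trans ?_
    rw [norm_mul]
    have := mul_le_mul_of_nonneg_right (hmD.1 hζ) (norm_nonneg a)
    linarith
  -- For `δ < δ₀` the linear term `2 δ μ` of `wormFun` beats the quadratic term `δ² B²`.
  set δ₀ := μ / (B ^ 2 + 1) with hδ₀
  have hδ₀0 : 0 < δ₀ := by positivity
  have hmem : ∀ ζ ∈ D, ∀ δ : ℝ, 0 < δ → δ < δ₀ →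
      pt ((δ : ℂ) * (z₀ + ζ * a)) (w₀ + ζ * b) ∈ wormDomain η := by
    intro ζ hζ δ h0 h1
    rw [mem_wormDomain]
    refine ⟨hw0 ζ (hmD.1 hζ), ?_⟩
    have h2 : δ * (B ^ 2 + 1) < μ := (lt_div_iff₀ (by positivity)).1 h1
    have h3 : μ ≤ ((z₀ + ζ * a) *
      Complex.exp (-(Complex.I * (logSq (pt 0 (w₀ + ζ * b)) : ℂ)))).re := hmin hζ
    have h4 : ‖z₀ + ζ * a‖ ^ 2 ≤ B ^ 2 := by
      have := hzB ζ hζ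
      gcongr
    rw [wormFun, logSq_pt, hη ζ (hmD.1 hζ), pt_zero, mul_assoc, Complex.re_ofReal_mul, norm_mul,
      mul_pow, Complex.norm_real, Real.norm_eq_abs, sq_abs]
    have h5 : δ * ‖z₀ + ζ * a‖ ^ 2 ≤ δ * B ^ 2 := by gcongr
    have h6 : 0 < δ * (2 * ((z₀ + ζ * a) *
      Complex.exp (-(Complex.I * (logSq (pt 0 (w₀ + ζ * b)) : ℂ)))).re -
        δ * ‖z₀ + ζ * a‖ ^ 2) := mul_pos h0 (by nlinarith)
    linarith
  have hmem0 : ∀ ζ ∈ D, pt 0 (w₀ + ζ * b) ∈ closure (wormDomain η) := fun ζ hζ =>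
    mem_closure_wormDomain (hw0 ζ (hmD.1 hζ)) (hη ζ (hmD.1 hζ))
      (by rw [zero_sub, norm_neg, norm_expI])
  have hneg : ∀ p ∈ wormDomain η, 0 < -ρ p := fun p hp => by
    rw [hΩ] at hp; linarith [hp.2]
  -- the uniform Lipschitz bound
  have hcl : IsCompact (closure (wormDomain η)) := hw.isBounded.isCompact_closure
  obtain ⟨C, hC⟩ := hcl.exists_bound_of_continuousOn
    ((hρ.continuousOn_fderiv_of_isOpen hU (by norm_num)).mono hUc)
  have hCn : 0 ≤ C := (norm_nonneg _).trans (hC _ (hmem0 0 (by simp [hD])))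
  have hderiv : ∀ ζ ∈ D, ∀ t : ℝ, 0 ≤ t → t < δ₀ →
      HasDerivAt (fun t : ℝ => -ρ (pt ((t : ℂ) * (z₀ + ζ * a)) (w₀ + ζ * b)))
        (-fderiv ℝ ρ (pt ((t : ℂ) * (z₀ + ζ * a)) (w₀ + ζ * b)) (pt (z₀ + ζ * a) 0)) t ∧
      ‖-fderiv ℝ ρ (pt ((t : ℂ) * (z₀ + ζ * a)) (w₀ + ζ * b)) (pt (z₀ + ζ * a) 0)‖ ≤ C * B := by
    intro ζ hζ t h0 h1
    have hm : pt ((t : ℂ) * (z₀ + ζ * a)) (w₀ + ζ * b) ∈ closure (wormDomain η) := by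
      rcases h0.eq_or_lt with h | h
      · rw [← h]; simpa using hmem0 ζ hζ
      · exact subset_closure (hmem ζ hζ t h h1)
    have hd := ((hρ.differentiableOn (by norm_num)).differentiableAt
      (hU.mem_nhds (hUc hm))).hasFDerivAt
    have hγ : HasDerivAt (fun t : ℝ => pt ((t : ℂ) * (z₀ + ζ * a)) (w₀ + ζ * b))
        (pt (z₀ + ζ * a) 0) t := by
      refine hasDerivAt_pt ?_ (hasDerivAt_const _ _)
      simpa using ((hasDerivAt_id t).ofReal_comp.mul_const (z₀ + ζ * a))
    refine ⟨(hd.comp_hasDerivAt t hγ).neg, ?_⟩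
    rw [norm_neg]
    refine (ContinuousLinearMap.le_opNorm _ _).trans ?_
    have hn : ‖pt (z₀ + ζ * a) 0‖ = ‖z₀ + ζ * a‖ := by
      simp [EuclideanSpace.norm_eq, Fin.sum_univ_two]
    rw [hn]
    exact mul_le_mul (hC _ hm) (hzB ζ hζ) (norm_nonneg _) hCn
  have hzero : ∀ ζ ∈ D, ρ (pt 0 (w₀ + ζ * b)) = 0 := fun ζ hζ =>
    eq_zero_of_fst_eq_zero hU hUc hρ hΩ (hw0 ζ (hmD.1 hζ)) (hη ζ (hmD.1 hζ))
  have hbound : ∀ ζ ∈ D, ∀ δ : ℝ, 0 < δ → δ < δ₀ →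
      δ⁻¹ * (-ρ (pt ((δ : ℂ) * (z₀ + ζ * a)) (w₀ + ζ * b))) ≤ C * B := by
    intro ζ hζ δ h0 h1
    have := norm_image_sub_le_of_norm_deriv_le_segment'
      (f := fun t : ℝ => -ρ (pt ((t : ℂ) * (z₀ + ζ * a)) (w₀ + ζ * b))) (a := 0) (b := δ)
      (fun t ht => (hderiv ζ hζ t ht.1 (ht.2.trans_lt h1)).1.hasDerivWithinAt)
      (fun t ht => (hderiv ζ hζ t ht.1 (ht.2.trans h1)).2) δ ⟨h0.le, le_rfl⟩
    simp only [Complex.ofReal_zero, zero_mul, hzero ζ hζ, neg_zero, sub_zero] at this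
    rw [inv_mul_le_iff₀ h0]
    calc _ ≤ _ := Real.le_norm_self _
      _ ≤ _ := this
      _ = _ := mul_comm _ _
  have hlim : ∀ ζ ∈ D, Tendsto (fun δ : ℝ =>
      (δ⁻¹ * (-ρ (pt ((δ : ℂ) * (z₀ + ζ * a)) (w₀ + ζ * b)))) ^ τ) (𝓝[>] 0)
      (𝓝 ((-fderiv ℝ ρ (pt 0 (w₀ + ζ * b)) (pt (z₀ + ζ * a) 0)) ^ τ)) := by
    intro ζ hζ
    have h1 := (hderiv ζ hζ 0 le_rfl hδ₀0).1.tendsto_slope_zero_right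
    simp only [zero_add, Complex.ofReal_zero, zero_mul, hzero ζ hζ, neg_zero, sub_zero,
      smul_eq_mul] at h1
    exact h1.rpow_const (Or.inr hτ0.le)
  have hcirc : ∀ θ, circleMap 0 1 θ ∈ D := fun θ => hmD.2 (by simp)
  have hIoo : ∀ᶠ δ in 𝓝[>] (0:ℝ), δ ∈ Ioo 0 δ₀ := Ioo_mem_nhdsGT hδ₀0
  have hdisc : ∀ δ : ℝ, ∀ ζ : ℂ, pt ((δ : ℂ) * z₀) w₀ + ζ • pt ((δ : ℂ) * a) b =
      pt ((δ : ℂ) * (z₀ + ζ * a)) (w₀ + ζ * b) := by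
    intro δ ζ
    rw [smul_pt, pt_add]
    congr 1
    ring
  have hcont : ∀ δ ∈ Ioo 0 δ₀, Continuous (fun θ : ℝ =>
      (δ⁻¹ * (-ρ (pt ((δ : ℂ) * (z₀ + circleMap 0 1 θ * a)) (w₀ + circleMap 0 1 θ * b)))) ^ τ) := by
    intro δ hδ
    have h1 : Continuous (fun θ : ℝ =>
        ρ (pt ((δ : ℂ) * (z₀ + circleMap 0 1 θ * a)) (w₀ + circleMap 0 1 θ * b))) :=
      (hρ.continuousOn.mono (subset_closure.trans hUc)).comp_continuous
        (continuous_pt (by fun_prop) (by fun_prop))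
        fun θ => hmem _ (hcirc θ) δ hδ.1 hδ.2
    exact (continuous_const.mul h1.neg).rpow_const fun θ => Or.inr hτ0.le
  have hineq : ∀ δ ∈ Ioo 0 δ₀, Real.circleAverage (fun ζ : ℂ =>
      (δ⁻¹ * (-ρ (pt ((δ : ℂ) * (z₀ + ζ * a)) (w₀ + ζ * b)))) ^ τ) 0 1 ≤
        (δ⁻¹ * (-ρ (pt ((δ : ℂ) * (z₀ + 0 * a)) (w₀ + 0 * b)))) ^ τ := by
    intro δ hδ
    have hin : ∀ ζ : ℂ, ‖ζ‖ ≤ 1 → pt ((δ : ℂ) * z₀) w₀ + ζ • pt ((δ : ℂ) * a) b ∈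
        wormDomain η := fun ζ hζ => by
      rw [hdisc]; exact hmem ζ (hmD.2 hζ) δ hδ.1 hδ.2
    have h1 := (hpsh.2 _ _ hin).2
    simp only [hdisc] at h1
    have hδi : 0 ≤ δ⁻¹ := inv_nonneg.2 hδ.1.le
    have h2 : Real.circleAverage (fun ζ : ℂ =>
        (δ⁻¹ * (-ρ (pt ((δ : ℂ) * (z₀ + ζ * a)) (w₀ + ζ * b)))) ^ τ) 0 1 =
        -δ⁻¹ ^ τ * Real.circleAverage (fun ζ : ℂ =>
          -(-ρ (pt ((δ : ℂ) * (z₀ + ζ * a)) (w₀ + ζ * b))) ^ τ) 0 1 := by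
      rw [← smul_eq_mul, ← Real.circleAverage_fun_smul]
      apply Real.circleAverage_congr_sphere
      intro ζ hζ
      have hζ' : ζ ∈ D := hmD.2 (by simpa using (mem_sphere_zero_iff_norm.1 hζ).le)
      simp only [smul_eq_mul]
      rw [Real.mul_rpow hδi (hneg _ (hmem ζ hζ' δ hδ.1 hδ.2)).le]
      ring
    rw [h2, Real.mul_rpow hδi (hneg _ (hmem 0 (by simp [hD]) δ hδ.1 hδ.2)).le]
    have h3 := mul_le_mul_of_nonneg_left h1 (Real.rpow_nonneg hδi τ)
    simp only [zero_mul, add_zero]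
    linarith
  have hlimavg : Tendsto (fun δ : ℝ => Real.circleAverage (fun ζ : ℂ =>
      (δ⁻¹ * (-ρ (pt ((δ : ℂ) * (z₀ + ζ * a)) (w₀ + ζ * b)))) ^ τ) 0 1) (𝓝[>] 0)
      (𝓝 (Real.circleAverage (fun ζ : ℂ =>
      (-fderiv ℝ ρ (pt 0 (w₀ + ζ * b)) (pt (z₀ + ζ * a) 0)) ^ τ) 0 1)) := by
    refine Tendsto.const_smul ?_ _
    refine intervalIntegral.tendsto_integral_filter_of_dominated_convergence
      (fun _ => (C * B) ^ τ) ?_ ?_ (by simp) ?_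
    · filter_upwards [hIoo] with δ hδ
      exact (hcont δ hδ).aestronglyMeasurable
    · filter_upwards [hIoo] with δ hδ
      refine Eventually.of_forall fun θ _ => ?_
      have h0 : 0 ≤ δ⁻¹ * (-ρ (pt ((δ : ℂ) * (z₀ + circleMap 0 1 θ * a))
          (w₀ + circleMap 0 1 θ * b))) :=
        mul_nonneg (inv_nonneg.2 hδ.1.le) (hneg _ (hmem _ (hcirc θ) δ hδ.1 hδ.2)).le
      rw [Real.norm_of_nonneg (Real.rpow_nonneg h0 _)]
      exact Real.rpow_le_rpow h0 (hbound _ (hcirc θ) δ hδ.1 hδ.2) hτ0.le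
    · exact Eventually.of_forall fun θ _ => hlim _ (hcirc θ)
  have hfin := le_of_tendsto_of_tendsto hlimavg (hlim 0 (by simp [hD]))
    (by filter_upwards [hIoo] with δ hδ using hineq δ hδ)
  simpa using hfin

/-! ### The model function and its Laplacian on the test disc -/

/-- The model function `|Re (z e^{-i log |w|²})|^τ cos(k log |w|²)^{1-τ}` along an affine disc. -/
def modelDisc (τ k : ℝ) (z₀ a w₀ b : ℂ) (ζ : ℂ) : ℝ :=
  ((z₀ + ζ * a) * Complex.exp (-(Complex.I * (logSq (pt 0 (w₀ + ζ * b)) : ℂ)))).re ^ τ *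
    Real.cos (k * logSq (pt 0 (w₀ + ζ * b))) ^ (1 - τ)

lemma logSq_pt_add_mul {w₀ ζ : ℂ} (hw : w₀ ≠ 0) (hζ : 1 + ζ ≠ 0) :
    logSq (pt 0 (w₀ + ζ * w₀)) = logSq (pt 0 w₀) + 2 * (Complex.log (1 + ζ)).re := by
  have e1 : w₀ + ζ * w₀ = w₀ * (1 + ζ) := by ring
  simp only [logSq, pt_one, e1, Complex.log_re, norm_mul]
  rw [mul_pow, Real.log_mul (by simpa using hw) (by simpa using hζ), Real.log_pow ‖1 + ζ‖]
  rfl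

/-- The centre is chosen so that `Re (z e^{-iL}) = cos (k L)`, and the direction so that the two
factors have equal logarithmic derivatives in the real direction. In the gradient-square loss of the
geometric mean only the imaginary direction then remains. Outside the case `k = τ / (1 - τ)` the
exponential weights no longer cancel; the leftover `exp (-2τ Im lw)` supplies the positive
contribution. -/
lemma hasLap_modelDisc {τ k L : ℝ} {w₀ : ℂ} (hw : w₀ ≠ 0) (hL : logSq (pt 0 w₀) = L)
    (hc : 0 < Real.cos (k * L)) :
    ∃ gx gy, HasLap (modelDisc τ k (Complex.exp (((1 + k) * L : ℝ) * Complex.I))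
      (2 * Complex.I * (1 + k) * Complex.exp (((1 + k) * L : ℝ) * Complex.I)) w₀ w₀)
      (Real.cos (k * L)) gx gy (4 * Real.cos (k * L) * ((τ * (1 + k)) ^ 2 - k ^ 2)) := by
  set z₀ := Complex.exp (((1 + k) * L : ℝ) * Complex.I) with hz₀
  set lw : ℂ → ℂ := fun ζ => Complex.log (1 + ζ) with hlwd
  have hlw0 : lw 0 = 0 := by simp [hlwd]
  have hlw : AnalyticAt ℂ lw 0 := by
    apply AnalyticAt.clog
    · fun_prop
    · simp
  have hlwD : HasDerivAt lw 1 0 := by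
    have h1 : HasDerivAt (fun ζ : ℂ => 1 + ζ) 1 0 := (hasDerivAt_id (0:ℂ)).const_add 1
    have := h1.clog (by simp)
    simpa using this
  set q : ℂ → ℂ := fun ζ => (z₀ + ζ * (2 * Complex.I * (1 + k) * z₀)) *
    (Complex.exp (-(Complex.I * (L : ℂ))) * Complex.exp (-(2 * Complex.I * lw ζ))) with hq
  have hqa : AnalyticAt ℂ q 0 := by
    have : AnalyticAt ℂ (fun ζ => Complex.exp (-(2 * Complex.I * lw ζ))) 0 :=
      (analyticAt_const.mul hlw).neg.cexp
    exact AnalyticAt.mul (by fun_prop) (analyticAt_const.mul this)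
  have hzL : z₀ * Complex.exp (-(Complex.I * (L : ℂ))) =
      Complex.exp ((k * L : ℝ) * Complex.I) := by
    rw [hz₀, ← Complex.exp_add]
    congr 1
    push_cast; ring
  have hq0 : q 0 = Complex.exp ((k * L : ℝ) * Complex.I) := by
    simp only [hq, hlw0, zero_mul, add_zero, mul_zero, neg_zero, Complex.exp_zero, mul_one, hzL]
  have hqD : deriv q 0 = (2 * k : ℝ) * Complex.I * Complex.exp ((k * L : ℝ) * Complex.I) := by
    have h1 : HasDerivAt (fun ζ : ℂ => z₀ + ζ * (2 * Complex.I * (1 + k) * z₀))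
        (1 * (2 * Complex.I * (1 + k) * z₀)) 0 :=
      ((hasDerivAt_id (0:ℂ)).mul_const _).const_add z₀
    have h2 := (hlwD.const_mul (2 * Complex.I)).neg.cexp.const_mul
      (Complex.exp (-(Complex.I * (L : ℂ))))
    have h3 := (h1.mul h2).deriv
    refine h3.trans ?_
    simp only [Pi.neg_apply, hlw0]
    rw [← hzL]
    simp
    ring
  have hre : (Complex.exp ((k * L : ℝ) * Complex.I)).re = Real.cos (k * L) :=
    Complex.exp_ofReal_mul_I_re _
  have him : (Complex.exp ((k * L : ℝ) * Complex.I)).im = Real.sin (k * L) :=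
    Complex.exp_ofReal_mul_I_im _
  have hA : HasLap (fun ζ => (q ζ).re) (Real.cos (k * L)) (-(2 * k * Real.sin (k * L)))
      (-(2 * k * Real.cos (k * L))) 0 := by
    refine (HasLap.re hqa).of_eq (by rw [hq0, hre]) ?_ ?_ rfl
    · rw [hqD, mul_assoc, Complex.re_ofReal_mul, Complex.I_mul_re, him]; ring
    · rw [hqD, mul_assoc, Complex.im_ofReal_mul, Complex.I_mul_im, hre]
  -- Here the cosine is left unweighted, and the whole exponential correction is carried by `hE`.
  have hX := (HasLap.const (k * L)).add ((HasLap.re hlw).const_mul (2 * k))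
  have hB : HasLap (fun ζ => Real.cos (k * L + 2 * k * (lw ζ).re)) (Real.cos (k * L))
      (-(2 * k * Real.sin (k * L))) 0 (-(4 * k ^ 2 * Real.cos (k * L))) := by
    have h2 : deriv Real.cos = fun x => -Real.sin x := funext fun x => by simp
    have h3 : ∀ x, deriv (fun x => -Real.sin x) x = -Real.cos x := fun x => by simp
    refine (hX.comp_contDiff (φ := Real.cos) Real.contDiff_cos).of_eq ?_ ?_ ?_ ?_
    · simp [hlw0]
    · simp [hlw0, hlwD.deriv]; ring
    · simp [hlwD.deriv]
    · rw [h2, h3]; simp [hlw0, hlwD.deriv]; ring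
  have hE := ((HasLap.im hlw).const_mul (-(2 * τ))).comp_contDiff (φ := Real.exp)
    (Real.contDiff_exp.of_le le_top)
  have hF := (hA.rpow_mul_rpow (τ := τ) hB hc hc).mul hE
  have hcc : Real.cos (k * L) ^ τ * Real.cos (k * L) ^ (1 - τ) = Real.cos (k * L) := by
    rw [← Real.rpow_add hc]; simp
  refine ⟨_, _, (hF.congr ?_).of_eq ?_ rfl rfl ?_⟩
  · have hn : ∀ᶠ ζ : ℂ in 𝓝 0, 1 + ζ ≠ 0 := by
      have hc : Continuous (fun ζ : ℂ => 1 + ζ) := by fun_prop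
      exact hc.continuousAt.eventually (isOpen_ne.mem_nhds (by simp))
    have hpos : ∀ᶠ ζ in 𝓝 (0:ℂ), 0 < (q ζ).re ∧ 0 < Real.cos (k * L + 2 * k * (lw ζ).re) := by
      have c1 : ContinuousAt (fun ζ => (q ζ).re) 0 :=
        Complex.continuous_re.continuousAt.comp hqa.continuousAt
      have c2 : ContinuousAt (fun ζ => Real.cos (k * L + 2 * k * (lw ζ).re)) 0 := by
        have c3 : ContinuousAt (fun ζ => (lw ζ).re) 0 :=
          Complex.continuous_re.continuousAt.comp hlw.continuousAt
        exact Real.continuous_cos.continuousAt.comp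
          (continuousAt_const.add (continuousAt_const.mul c3))
      exact (c1.eventually (lt_mem_nhds (by beta_reduce; rwa [hq0, hre]))).and
        (c2.eventually (lt_mem_nhds (by simpa [hlw0] using hc)))
    filter_upwards [hn, hpos] with ζ hζ hp
    have hl := logSq_pt_add_mul hw hζ
    rw [hL] at hl
    have n1 : (z₀ + ζ * (2 * Complex.I * (1 + k) * z₀)) *
        Complex.exp (-(Complex.I * ((L + 2 * (lw ζ).re : ℝ) : ℂ))) =
          q ζ * ((Real.exp (-(2 * (lw ζ).im)) : ℝ) : ℂ) := by
      rw [Complex.ofReal_exp, hq]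
      simp only [mul_assoc, ← Complex.exp_add]
      congr 2
      have e := Complex.re_add_im (lw ζ)
      generalize (lw ζ).re = x at e ⊢
      generalize (lw ζ).im = y at e ⊢
      rw [← e]
      push_cast
      ring_nf
      rw [Complex.I_sq]
      ring
    rw [modelDisc, hl]
    change ((z₀ + ζ * (2 * Complex.I * (1 + k) * z₀)) *
        Complex.exp (-(Complex.I * ((L + 2 * (lw ζ).re : ℝ) : ℂ)))).re ^ τ *
        Real.cos (k * (L + 2 * (lw ζ).re)) ^ (1 - τ) = _
    rw [n1, Complex.re_mul_ofReal, Real.mul_rpow hp.1.le (Real.exp_pos _).le, ← Real.exp_mul,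
      show k * (L + 2 * (lw ζ).re) = k * L + 2 * k * (lw ζ).re by ring,
      show -(2 * (lw ζ).im) * τ = -(2 * τ) * (lw ζ).im by ring]
    ring
  · rw [hcc]; simp [hlw0]
  · rw [hcc]
    simp only [hlw0, hlwD.deriv, Complex.zero_im, Complex.one_re, Complex.one_im, mul_zero,
      Real.deriv_exp, Real.exp_zero]
    field_simp
    ring

lemma contDiffAt_modelDisc {τ k : ℝ} {z₀ a w₀ b : ℂ} (hw : w₀ ≠ 0)
    (h1 : 0 < (z₀ * Complex.exp (-(Complex.I * (logSq (pt 0 w₀) : ℂ)))).re)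
    (h2 : 0 < Real.cos (k * logSq (pt 0 w₀))) : ContDiffAt ℝ 2 (modelDisc τ k z₀ a w₀ b) 0 := by
  have hp : ContDiff ℝ 2 (fun ζ : ℂ => pt 0 (w₀ + ζ * b)) := by
    simp only [pt_eq]
    fun_prop
  have hL : ContDiffAt ℝ 2 (fun ζ : ℂ => logSq (pt 0 (w₀ + ζ * b))) 0 := by
    have h : ContDiffAt ℝ 2 logSq (pt 0 (w₀ + 0 * b)) :=
      contDiffOn_logSq.contDiffAt (isOpen_snd_ne_zero.mem_nhds (by simpa using hw))
    exact ContDiffAt.comp (g := logSq) (f := fun ζ : ℂ => pt 0 (w₀ + ζ * b)) (0:ℂ) h hp.contDiffAt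
  have hLc : ContDiffAt ℝ 2 (fun ζ : ℂ => ((logSq (pt 0 (w₀ + ζ * b)) : ℝ) : ℂ)) 0 :=
    Complex.ofRealCLM.contDiff.contDiffAt.comp (0:ℂ) hL
  have hz : ContDiffAt ℝ 2 (fun ζ : ℂ => z₀ + ζ * a) 0 := by fun_prop
  have hX : ContDiffAt ℝ 2 (fun ζ : ℂ => ((z₀ + ζ * a) *
      Complex.exp (-(Complex.I * (logSq (pt 0 (w₀ + ζ * b)) : ℂ)))).re) 0 :=
    Complex.reCLM.contDiff.contDiffAt.comp (0:ℂ)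
      (hz.mul (contDiffAt_const.mul hLc).neg.cexp)
  have hY : ContDiffAt ℝ 2 (fun ζ : ℂ => Real.cos (k * logSq (pt 0 (w₀ + ζ * b)))) 0 :=
    Real.contDiff_cos.contDiffAt.comp (0:ℂ) (contDiffAt_const.mul hL)
  exact (hX.rpow_const_of_ne (by simpa using h1.ne')).mul
    (hY.rpow_const_of_ne (by simpa using h2.ne'))

lemma continuousOn_normalDeriv {U : Set (EuclideanSpace ℂ (Fin 2))}
    {ρ : EuclideanSpace ℂ (Fin 2) → ℝ} (hU : IsOpen U) (hρ : ContDiffOn ℝ 2 ρ U) {K : Set ℂ}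
    (hK : ∀ w ∈ K, w ≠ 0 ∧ pt 0 w ∈ U) : ContinuousOn (normalDeriv ρ) K := by
  have hp : Continuous (fun w : ℂ => pt 0 w) := continuous_pt continuous_const continuous_id
  have hL : ContinuousOn (fun w : ℂ => ((logSq (pt 0 w) : ℝ) : ℂ)) K :=
    Complex.continuous_ofReal.comp_continuousOn
      ((contDiffOn_logSq (n := 0)).continuousOn.comp hp.continuousOn fun w hw => (hK w hw).1)
  have h1 : ContinuousOn (fun w : ℂ => fderiv ℝ ρ (pt 0 w)) K :=
    (hρ.continuousOn_fderiv_of_isOpen hU (by norm_num)).comp hp.continuousOn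
      fun w hw => (hK w hw).2
  have h2 : ContinuousOn (fun w : ℂ =>
      pt (Complex.exp (Complex.I * (logSq (pt 0 w) : ℂ))) 0) K := by
    simp only [pt_eq (Complex.exp _)]
    exact ((Complex.continuous_exp.comp_continuousOn (continuousOn_const.mul hL)).smul
      continuousOn_const).add continuousOn_const
  exact (h1.clm_apply h2).neg

/-! ### No exponent exceeds `π/(2β)` -/

theorem IsWormProfile.le_of_isDFExponent {β : ℝ} {η : ℝ → ℝ} (hw : IsWormProfile β η)
    (hβ : Real.pi / 2 < β) {τ : ℝ} (h : IsDFExponent (wormDomain η) τ) :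
    τ ≤ Real.pi / (2 * β) := by
  obtain ⟨hτ0, hτ1, ρ, ⟨U, hU, hUc, hρ, hΩ, hgrad⟩, hpsh⟩ := h
  by_contra hcon
  rw [not_le] at hcon
  have hpi := Real.pi_pos
  have hβ0 : 0 < β := by linarith
  have hτ' : 0 < 1 - τ := by linarith
  set l := β - Real.pi / 2 with hl
  have hl0 : 0 < l := by linarith
  -- The lower bound puts the first zero `s` of `cos (k x)` strictly inside the zero set of `η`; the
  -- upper bound makes the Laplacian of the model positive. Both are possible exactly because `τ >
  -- π/(2β)`.
  obtain ⟨k, hk1, hk2⟩ : ∃ k, Real.pi / (2 * l) < k ∧ k < τ / (1 - τ) := by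
    apply exists_between
    rw [div_lt_div_iff₀ (by linarith) hτ']
    have := (div_lt_iff₀ (by linarith)).1 hcon
    rw [hl]; linarith
  have hk0 : 0 < k := lt_trans (by positivity) hk1
  have hkτ : k < τ * (1 + k) := by
    have := (lt_div_iff₀ hτ').1 hk2
    linarith
  set s := Real.pi / (2 * k) with hs
  have hs0 : 0 < s := by positivity
  have hsl : s < l := by
    rw [hs, div_lt_iff₀ (by linarith)]
    have := (div_lt_iff₀ (by linarith)).1 hk1
    linarith
  have hks : k * s = Real.pi / 2 := by rw [hs]; field_simp
  have hcos : ∀ L, |L| < s → 0 < Real.cos (k * L) := by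
    intro L hL
    apply Real.cos_pos_of_mem_Ioo
    rw [abs_lt] at hL
    constructor <;> nlinarith
  have hcos' : ∀ L, |L| ≤ s → 0 ≤ Real.cos (k * L) := by
    intro L hL
    apply Real.cos_nonneg_of_mem_Icc
    rw [abs_le] at hL
    constructor <;> nlinarith
  -- the critical annulus
  set K : Set ℂ := {w | Real.exp (-s) ≤ ‖w‖ ^ 2 ∧ ‖w‖ ^ 2 ≤ Real.exp s} with hK
  have hK0 : ∀ w ∈ K, w ≠ 0 ∧ |logSq (pt 0 w)| ≤ s := by
    intro w hwK
    have h0 : w ≠ 0 := by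
      rintro rfl
      have := hwK.1
      have h2 := Real.exp_pos (-s)
      norm_num at this
      linarith
    have h1 : 0 < ‖w‖ ^ 2 := by positivity
    exact ⟨h0, abs_le.2 ⟨(Real.le_log_iff_exp_le h1).2 hwK.1, (Real.log_le_iff_le_exp h1).2 hwK.2⟩⟩
  have hKmem : ∀ w : ℂ, w ≠ 0 → |logSq (pt 0 w)| ≤ s → w ∈ K := by
    intro w h0 hL
    have h1 : 0 < ‖w‖ ^ 2 := by positivity
    rw [abs_le] at hL
    exact ⟨(Real.le_log_iff_exp_le h1).1 hL.1, (Real.log_le_iff_le_exp h1).1 hL.2⟩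
  have hKη : ∀ w ∈ K, η (logSq (pt 0 w)) = 0 := fun w hwK =>
    hw.eq_zero_iff.2 ((hK0 w hwK).2.trans hsl.le)
  have hKpos : ∀ w ∈ K, 0 < normalDeriv ρ w := fun w hwK =>
    normalDeriv_pos hw hU hUc hρ hΩ hgrad (hK0 w hwK).1 ((hK0 w hwK).2.trans_lt hsl)
  have hKU : ∀ w ∈ K, w ≠ 0 ∧ pt 0 w ∈ U := fun w hwK =>
    ⟨(hK0 w hwK).1, mem_of_fst_eq_zero hUc (hK0 w hwK).1 (hKη w hwK)⟩
  have hKc : IsCompact K := by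
    refine Metric.isCompact_of_isClosed_isBounded ?_ ?_
    · have hn : Continuous (fun w : ℂ => ‖w‖ ^ 2) := by fun_prop
      exact (isClosed_le continuous_const hn).inter (isClosed_le hn continuous_const)
    · refine isBounded_iff_forall_norm_le.2 ⟨Real.sqrt (Real.exp s), fun w hwK => ?_⟩
      exact Real.le_sqrt_of_sq_le hwK.2
  have hKcont := continuousOn_normalDeriv hU hρ hKU
  have hLcont : ContinuousOn (fun w : ℂ => logSq (pt 0 w)) K :=
    (contDiffOn_logSq (n := 0)).continuousOn.comp
      (continuous_pt continuous_const continuous_id).continuousOn fun w hwK => (hK0 w hwK).1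
  have hGcont : ContinuousOn (fun w : ℂ =>
      Real.cos (k * logSq (pt 0 w)) ^ (1 - τ) / normalDeriv ρ w ^ τ) K := by
    refine ContinuousOn.div ?_ ?_ fun w hwK => (Real.rpow_pos_of_pos (hKpos w hwK) _).ne'
    · exact (Real.continuous_cos.comp_continuousOn (continuousOn_const.mul hLcont)).rpow_const
        fun w _ => Or.inr hτ'.le
    · exact hKcont.rpow_const fun w _ => Or.inr hτ0.le
  have h1K : (1:ℂ) ∈ K := hKmem 1 one_ne_zero (by simpa [logSq] using hs0.le)
  -- The quotient vanishes on the edges `|L| = s` and is positive at `w = 1`, so the maximum is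
  -- attained in the interior.
  obtain ⟨w₀, hw₀K, hmax⟩ := hKc.exists_isMaxOn ⟨1, h1K⟩ hGcont
  set L := logSq (pt 0 w₀) with hL
  have hw₀ := hK0 w₀ hw₀K
  have hh₀ := hKpos w₀ hw₀K
  have hcL : 0 < Real.cos (k * L) := by
    refine lt_of_le_of_ne (hcos' L hw₀.2) fun h0 => ?_
    have h1 := hmax h1K
    simp only [mem_ofPred_eq] at h1
    rw [← hL, ← h0, Real.zero_rpow hτ'.ne', zero_div] at h1
    have h2 : 0 < Real.cos (k * logSq (pt 0 1)) ^ (1 - τ) / normalDeriv ρ 1 ^ τ := by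
      refine div_pos (Real.rpow_pos_of_pos (hcos _ ?_) _) (Real.rpow_pos_of_pos (hKpos 1 h1K) _)
      simpa [logSq] using hs0
    linarith
  have hLs : |L| < s := by
    refine lt_of_le_of_ne hw₀.2 fun h0 => ?_
    rw [← Real.cos_abs, abs_mul, h0, abs_of_pos hk0, hks, Real.cos_pi_div_two] at hcL
    exact lt_irrefl _ hcL
  -- the test disc
  set z₀ := Complex.exp (((1 + k) * L : ℝ) * Complex.I) with hz₀
  set a := 2 * Complex.I * (1 + k) * z₀ with ha
  have hX0 : (z₀ * Complex.exp (-(Complex.I * (L : ℂ)))).re = Real.cos (k * L) := by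
    have : z₀ * Complex.exp (-(Complex.I * (L : ℂ))) = Complex.exp ((k * L : ℝ) * Complex.I) := by
      rw [hz₀, ← Complex.exp_add]
      congr 1
      push_cast; ring
    rw [this, Complex.exp_ofReal_mul_I_re]
  set F := modelDisc τ k z₀ a w₀ w₀ with hF
  have hFc : ContDiffAt ℝ 2 F 0 := contDiffAt_modelDisc hw₀.1 (by rwa [← hL, hX0]) hcL
  obtain ⟨gx, gy, hlap⟩ := hasLap_modelDisc (τ := τ) hw₀.1 hL.symm hcL
  obtain ⟨δ₁, hδ₁, hlt⟩ := hlap.lt_circleAverage hFc (by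
    have : k ^ 2 < (τ * (1 + k)) ^ 2 := by gcongr
    have : 0 < (τ * (1 + k)) ^ 2 - k ^ 2 := by linarith
    positivity)
  have hev : ∀ᶠ ζ : ℂ in 𝓝 0, (w₀ + ζ * w₀ ≠ 0 ∧ |logSq (pt 0 (w₀ + ζ * w₀))| < s ∧
      0 < ((z₀ + ζ * a) *
        Complex.exp (-(Complex.I * (logSq (pt 0 (w₀ + ζ * w₀)) : ℂ)))).re) ∧ ContinuousAt F ζ := by
    have hp : Continuous (fun ζ : ℂ => pt 0 (w₀ + ζ * w₀)) :=
      continuous_pt continuous_const (by fun_prop)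
    have cL : ContinuousAt (fun ζ : ℂ => logSq (pt 0 (w₀ + ζ * w₀))) 0 := by
      have h : ContinuousAt logSq (pt 0 (w₀ + 0 * w₀)) :=
        (contDiffOn_logSq (n := 0)).continuousOn.continuousAt
          (isOpen_snd_ne_zero.mem_nhds (by simpa using hw₀.1))
      exact ContinuousAt.comp (f := fun ζ : ℂ => pt 0 (w₀ + ζ * w₀)) h hp.continuousAt
    have cX : ContinuousAt (fun ζ : ℂ => ((z₀ + ζ * a) *
        Complex.exp (-(Complex.I * (logSq (pt 0 (w₀ + ζ * w₀)) : ℂ)))).re) 0 := by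
      have c1 : ContinuousAt (fun ζ : ℂ => z₀ + ζ * a) 0 := by fun_prop
      have c2 : ContinuousAt (fun ζ : ℂ => ((logSq (pt 0 (w₀ + ζ * w₀)) : ℝ) : ℂ)) 0 :=
        Complex.continuous_ofReal.continuousAt.comp cL
      have c3 : ContinuousAt (fun ζ : ℂ =>
          Complex.exp (-(Complex.I * (logSq (pt 0 (w₀ + ζ * w₀)) : ℂ)))) 0 :=
        Complex.continuous_exp.continuousAt.comp (continuousAt_const.mul c2).neg
      exact Complex.continuous_re.continuousAt.comp (c1.mul c3)
    have c0 : ContinuousAt (fun ζ : ℂ => w₀ + ζ * w₀) 0 := by fun_prop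
    refine ((c0.eventually (isOpen_ne.mem_nhds (by simpa using hw₀.1))).and
      ((cL.abs.eventually (gt_mem_nhds (by simpa using hLs))).and
      (cX.eventually (lt_mem_nhds (by simpa [← hL, hX0] using hcL))))).and ?_
    filter_upwards [hFc.eventually (by simp)] with ζ hζ using hζ.continuousAt
  obtain ⟨δ₂, hδ₂, hball⟩ := Metric.eventually_nhds_iff_ball.1 hev
  obtain ⟨ε, hε0, hε⟩ := exists_between (lt_min hδ₁ hδ₂)
  have hdisc : ∀ ζ : ℂ, ‖ζ‖ ≤ 1 → 0 + ζ • (ε : ℂ) ∈ Metric.ball (0:ℂ) δ₂ := by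
    intro ζ hζ
    rw [mem_ball_zero_iff, zero_add, norm_smul, Complex.norm_real, Real.norm_eq_abs,
      abs_of_pos hε0]
    have := hε.trans_le (min_le_right _ _)
    nlinarith
  have hsm : ∀ ζ c : ℂ, ζ * (ε * c) = (0 + ζ • (ε : ℂ)) * c := fun ζ c => by
    rw [zero_add, smul_eq_mul, mul_assoc]
  have hin : ∀ ζ : ℂ, ‖ζ‖ ≤ 1 → w₀ + ζ * (ε * w₀) ∈ K := fun ζ hζ => by
    rw [hsm]
    obtain ⟨⟨h1, h2, -⟩, -⟩ := hball _ (hdisc ζ hζ)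
    exact hKmem _ h1 h2.le
  have hmain := circleAverage_fderiv_rpow_le hw hU hUc hρ hΩ hτ0 hpsh z₀ (ε * a) w₀ (ε * w₀)
    (fun ζ hζ => (hK0 _ (hin ζ hζ)).1) (fun ζ hζ => hKη _ (hin ζ hζ))
    (fun ζ hζ => by rw [hsm, hsm]; exact (hball _ (hdisc ζ hζ)).1.2.2)
  rw [fderiv_pt_zero hU hUc hρ hΩ hw₀.1 (hKη w₀ hw₀K), ← hL, hX0,
    Real.mul_rpow hh₀.le hcL.le] at hmain
  -- The reciprocal of the maximum: `c cos (k L)^(1-τ) ≤ h^τ` on the annulus, with equality at `w₀`.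
  -- Hence `c F` lies below the blow-up limit on the disc and agrees with it at the centre, against
  -- the strict inequality `hlt`.
  set c := normalDeriv ρ w₀ ^ τ / Real.cos (k * L) ^ (1 - τ) with hc
  have hh₀τ : 0 < normalDeriv ρ w₀ ^ τ := Real.rpow_pos_of_pos hh₀ _
  have hcLτ : 0 < Real.cos (k * L) ^ (1 - τ) := Real.rpow_pos_of_pos hcL _
  have hc0 : 0 < c := div_pos hh₀τ hcLτ
  have hpt : ∀ ζ : ℂ, ‖ζ‖ ≤ 1 → c • F (0 + ζ • (ε : ℂ)) ≤
      (-fderiv ℝ ρ (pt 0 (w₀ + ζ * (ε * w₀))) (pt (z₀ + ζ * (ε * a)) 0)) ^ τ := by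
    intro ζ hζ
    have hK' := hin ζ hζ
    rw [fderiv_pt_zero hU hUc hρ hΩ (hK0 _ hK').1 (hKη _ hK')]
    have hm := hmax hK'
    have hh := hKpos _ hK'
    obtain ⟨⟨-, -, hx⟩, -⟩ := hball _ (hdisc ζ hζ)
    simp only [mem_ofPred_eq] at hm
    rw [hsm] at hm hh ⊢
    rw [hsm, Real.mul_rpow hh.le hx.le, hF, modelDisc, smul_eq_mul]
    rw [div_le_div_iff₀ (Real.rpow_pos_of_pos hh _) hh₀τ, ← hL] at hm
    rw [mul_left_comm, mul_comm]
    refine mul_le_mul_of_nonneg_right ?_ (Real.rpow_nonneg hx.le _)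
    rw [hc, div_mul_eq_mul_div, div_le_iff₀ hcLτ]
    linarith
  have hFcont : ContinuousOn F (Metric.ball 0 δ₂) := fun ζ hζ =>
    (hball ζ hζ).2.continuousWithinAt
  have hFint : CircleIntegrable (fun ζ : ℂ => F (0 + ζ • (ε : ℂ))) 0 1 :=
    circleIntegrable_comp_disc hFcont hdisc
  have hint : CircleIntegrable (fun ζ : ℂ =>
      (-fderiv ℝ ρ (pt 0 (w₀ + ζ * (ε * w₀))) (pt (z₀ + ζ * (ε * a)) 0)) ^ τ) 0 1 := by
    have h1 : Continuous (fun θ : ℝ => fderiv ℝ ρ (pt 0 (w₀ + circleMap 0 1 θ * (ε * w₀)))) :=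
      (hρ.continuousOn_fderiv_of_isOpen hU (by norm_num)).comp_continuous
        (continuous_pt continuous_const (by fun_prop))
        fun θ => (hKU _ (hin _ (by simp))).2
    have h2 : Continuous (fun θ : ℝ => pt (z₀ + circleMap 0 1 θ * (ε * a)) 0) :=
      continuous_pt (by fun_prop) continuous_const
    have h3 : Continuous (fun θ : ℝ => (-fderiv ℝ ρ (pt 0 (w₀ + circleMap 0 1 θ * (ε * w₀)))
        (pt (z₀ + circleMap 0 1 θ * (ε * a)) 0)) ^ τ) :=
      (h1.clm_apply h2).neg.rpow_const fun θ => Or.inr hτ0.le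
    exact h3.intervalIntegrable _ _
  have havg := (Real.circleAverage_mono (hFint.const_fun_smul (a := c)) hint fun ζ hζ =>
    hpt ζ (by simpa using (mem_sphere_zero_iff_norm.1 hζ).le)).trans hmain
  rw [Real.circleAverage_fun_smul, smul_eq_mul] at havg
  have hF0 : F 0 = Real.cos (k * L) ^ τ * Real.cos (k * L) ^ (1 - τ) := by
    rw [hF, modelDisc]
    simp only [zero_mul, add_zero, ← hL, hX0]
  have hlt' := mul_lt_mul_of_pos_left (hlt ε hε0 (hε.trans_le (min_le_left _ _))) hc0
  have e : c * F 0 = normalDeriv ρ w₀ ^ τ * Real.cos (k * L) ^ τ := by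
    rw [hF0, hc]; field_simp
  linarith

/-! ### Existence of admissible profiles -/

/-- A smooth convex function vanishing exactly on `(-∞, 0]`. -/
def convexRamp (x : ℝ) : ℝ := ∫ t in (0:ℝ)..x, expNegInvGlue t

lemma continuous_expNegInvGlue : Continuous expNegInvGlue :=
  (expNegInvGlue.contDiff (n := 0)).continuous

lemma hasDerivAt_convexRamp (x : ℝ) : HasDerivAt convexRamp (expNegInvGlue x) x :=
  intervalIntegral.integral_hasDerivAt_right (continuous_expNegInvGlue.intervalIntegrable _ _)
    (continuous_expNegInvGlue.stronglyMeasurableAtFilter _ _) continuous_expNegInvGlue.continuousAt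

lemma deriv_convexRamp : deriv convexRamp = expNegInvGlue :=
  funext fun x => (hasDerivAt_convexRamp x).deriv

lemma contDiff_convexRamp : ContDiff ℝ ∞ convexRamp := by
  rw [contDiff_infty_iff_deriv, deriv_convexRamp]
  exact ⟨fun x => (hasDerivAt_convexRamp x).differentiableAt,
    expNegInvGlue.contDiff (n := (⊤ : ℕ∞))⟩

lemma convexOn_convexRamp : ConvexOn ℝ univ convexRamp := by
  apply Monotone.convexOn_univ_of_deriv fun x => (hasDerivAt_convexRamp x).differentiableAt
  rw [deriv_convexRamp]
  exact expNegInvGlue.monotone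

lemma convexRamp_of_nonpos {x : ℝ} (hx : x ≤ 0) : convexRamp x = 0 := by
  have : ∫ t in (0:ℝ)..x, expNegInvGlue t = ∫ t in (0:ℝ)..x, (0:ℝ) := by
    apply intervalIntegral.integral_congr
    intro t ht
    rw [uIcc_of_ge hx] at ht
    exact expNegInvGlue.zero_of_nonpos ht.2
  rw [convexRamp, this]; simp

lemma convexRamp_pos {x : ℝ} (hx : 0 < x) : 0 < convexRamp x :=
  intervalIntegral.intervalIntegral_pos_of_pos_on
    (continuous_expNegInvGlue.intervalIntegrable _ _)
    (fun _ ht => expNegInvGlue.pos_of_pos ht.1) hx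

lemma convexRamp_nonneg (x : ℝ) : 0 ≤ convexRamp x := by
  rcases le_or_gt x 0 with h | h
  · exact (convexRamp_of_nonpos h).ge
  · exact (convexRamp_pos h).le

/-- Convexity together with the value `0` at `0`; the resulting linear growth makes the profile
exceed `1` far out. -/
lemma mul_convexRamp_one_le {x : ℝ} (hx : 1 ≤ x) : x * convexRamp 1 ≤ convexRamp x := by
  have hx0 : 0 < x := by linarith
  have h := convexOn_convexRamp.2 (mem_univ 0) (mem_univ x)
    (show (0:ℝ) ≤ 1 - x⁻¹ from sub_nonneg.2 (inv_le_one_of_one_le₀ hx))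
    (show (0:ℝ) ≤ x⁻¹ by positivity) (by ring)
  simp only [smul_eq_mul, mul_zero, zero_add, inv_mul_cancel₀ hx0.ne',
    convexRamp_of_nonpos le_rfl] at h
  rwa [← div_eq_inv_mul, le_div_iff₀ hx0, mul_comm] at h

lemma exists_isWormProfile {β : ℝ} (hβ : Real.pi / 2 < β) : ∃ η : ℝ → ℝ, IsWormProfile β η := by
  set l := β - Real.pi / 2 with hl
  have hl0 : 0 < l := by linarith
  have hd : ∀ x, HasDerivAt (fun x => convexRamp (x - l) + convexRamp (-x - l))
      (expNegInvGlue (x - l) + expNegInvGlue (-x - l) * -1) x := by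
    intro x
    have h1 := (hasDerivAt_convexRamp (x - l)).comp x ((hasDerivAt_id x).sub_const l)
    have h2 := (hasDerivAt_convexRamp (-x - l)).comp x (((hasDerivAt_id x).neg).sub_const l)
    refine (h1.add h2).congr_deriv ?_
    simp
  refine ⟨fun x => convexRamp (x - l) + convexRamp (-x - l), ?_, ?_, ?_, ?_, ?_, ?_, ?_⟩
  · exact (contDiff_convexRamp.comp (contDiff_id.sub contDiff_const)).add
      (contDiff_convexRamp.comp (contDiff_id.neg.sub contDiff_const))
  · exact fun x => add_nonneg (convexRamp_nonneg _) (convexRamp_nonneg _)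
  · intro x
    rw [neg_neg, add_comm]
  · apply Monotone.convexOn_univ_of_deriv fun x => (hd x).differentiableAt
    rw [show deriv (fun x => convexRamp (x - l) + convexRamp (-x - l)) = fun x =>
      expNegInvGlue (x - l) + expNegInvGlue (-x - l) * -1 from funext fun x => (hd x).deriv]
    intro x y hxy
    have h1 := expNegInvGlue.monotone (sub_le_sub_right hxy l)
    have h2 := expNegInvGlue.monotone (sub_le_sub_right (neg_le_neg hxy) l)
    beta_reduce
    linarith
  · ext x
    simp only [mem_preimage, mem_singleton_iff, mem_Icc]
    constructor
    · intro h
      have h1 := convexRamp_nonneg (x - l)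
      have h2 := convexRamp_nonneg (-x - l)
      constructor
      · by_contra hc
        have := convexRamp_pos (x := -x - l) (by linarith)
        linarith
      · by_contra hc
        have := convexRamp_pos (x := x - l) (by linarith)
        linarith
    · rintro ⟨h1, h2⟩
      rw [convexRamp_of_nonpos (by linarith), convexRamp_of_nonpos (by linarith), add_zero]
  · have h1 := convexRamp_pos one_pos
    have hinv : 0 < (convexRamp 1)⁻¹ := inv_pos.2 h1
    have key : ∀ y, 1 + (convexRamp 1)⁻¹ < y → 1 < convexRamp y := by
      intro y hy
      refine lt_of_lt_of_le ?_ (mul_convexRamp_one_le (by linarith))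
      have : (convexRamp 1)⁻¹ * convexRamp 1 < y * convexRamp 1 := by
        apply mul_lt_mul_of_pos_right _ h1
        linarith
      rwa [inv_mul_cancel₀ h1.ne'] at this
    refine ⟨l + 1 + (convexRamp 1)⁻¹, by positivity, fun x hx => ?_⟩
    rcases hx with hx | hx
    · have := key (-x - l) (by linarith)
      have := convexRamp_nonneg (x - l)
      linarith
    · have := key (x - l) (by linarith)
      have := convexRamp_nonneg (-x - l)
      linarith
  · intro x hx
    rw [(hd x).deriv]
    beta_reduce at hx
    rcases lt_or_ge l x with h | h
    · have h1 := expNegInvGlue.pos_of_pos (sub_pos.2 h)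
      rw [expNegInvGlue.zero_of_nonpos (x := -x - l) (by linarith)]
      simpa using h1.ne'
    · rw [convexRamp_of_nonpos (x := x - l) (by linarith), zero_add] at hx
      have h2 : 0 < -x - l := by
        by_contra hc
        rw [convexRamp_of_nonpos (not_lt.1 hc)] at hx
        exact zero_ne_one hx
      have h1 := expNegInvGlue.pos_of_pos h2
      rw [expNegInvGlue.zero_of_nonpos (x := x - l) (by linarith)]
      simpa using h1.ne'

/-! ### Assembly -/

theorem IsWormProfile.isSmoothBoundedPseudoconvexDomain {β : ℝ} {η : ℝ → ℝ}
    (hw : IsWormProfile β η) (hβ : Real.pi / 2 < β) :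
    IsSmoothBoundedPseudoconvexDomain (wormDomain η) := by
  have hβ0 : 0 < Real.pi / (2 * β) := by
    have := Real.pi_pos
    exact div_pos this (by linarith)
  have hopen := isOpen_wormDomain hw.smooth.continuous
  exact ⟨hopen, hw.isConnected hβ, hw.isBounded, hw.exists_smooth_definingFunction,
    (hw.isDFExponent hβ (half_pos hβ0) (half_lt_self hβ0)).isPseudoconvex hopen hw.isBounded⟩

theorem IsWormProfile.dfIndex_eq {β : ℝ} {η : ℝ → ℝ} (hw : IsWormProfile β η)
    (hβ : Real.pi / 2 < β) : dfIndex (wormDomain η) = Real.pi / (2 * β) := by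
  have hβ0 : 0 < Real.pi / (2 * β) := by
    have := Real.pi_pos
    exact div_pos this (by linarith)
  refine csSup_eq_of_forall_le_of_forall_lt_exists_gt
    ⟨_, hw.isDFExponent hβ (half_pos hβ0) (half_lt_self hβ0)⟩
    (fun τ hτ => hw.le_of_isDFExponent hβ hτ) fun y hy => ?_
  -- The maximum with `0` keeps the chosen exponent positive when `y` is negative.
  obtain ⟨τ, h1, h2⟩ := exists_between (max_lt hy hβ0)
  exact ⟨τ, hw.isDFExponent hβ ((le_max_right _ _).trans_lt h1) h2, (le_max_left _ _).trans_lt h1⟩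

end

theorem theorem4p3 :
    (∀ (β : ℝ) (η : ℝ → ℝ), Real.pi / 2 < β → IsWormProfile β η →
      IsSmoothBoundedPseudoconvexDomain (wormDomain η) ∧
        dfIndex (wormDomain η) = Real.pi / (2 * β)) ∧
    (∀ η₀ : ℝ, 0 < η₀ → η₀ < 1 →
      ∃ η : ℝ → ℝ, IsWormProfile (Real.pi / (2 * η₀)) η ∧
        IsSmoothBoundedPseudoconvexDomain (wormDomain η) ∧
        dfIndex (wormDomain η) = η₀) := by
  have hpi := Real.pi_pos
  refine ⟨fun β η hβ hw => ⟨hw.isSmoothBoundedPseudoconvexDomain hβ, hw.dfIndex_eq hβ⟩,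
    fun η₀ h0 h1 => ?_⟩
  have hβ : Real.pi / 2 < Real.pi / (2 * η₀) := by
    apply div_lt_div_of_pos_left hpi (by positivity)
    linarith
  obtain ⟨η, hw⟩ := exists_isWormProfile hβ
  refine ⟨η, hw, hw.isSmoothBoundedPseudoconvexDomain hβ, ?_⟩
  rw [hw.dfIndex_eq hβ]
  field_simp
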